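/- Let $I=[0,1]$ and let $F:I\times[0,\infty)\to\mathbb R$ be bounded, with $F$, $\frac{\partial F}{\partial x}$, $\frac{\partial^2 F}{\partial x^2}$ existing and continuous on $I\times[0,\infty)$, and with $F(0,t)=F(1,t)=0$ and $\frac{\partial^2F}{\partial x^2}(0,t)=\frac{\partial^2F}{\partial x^2}(1,t)=0$ for all $t\ge 0$ (derivatives at boundary points are one-sided). For $m\in\mathbb C$ with $m=0$ or $\sinh m\neq0$, and $x,y\in I$, put $$g(m,x,y)=\frac{-1}{m\sinh m}\begin{cases}\sinh(m(x-1))\sinh(my), & y\le x,\\ \sinh(mx)\sinh(m(y-1)), & x<y,\end{cases}\quad (m\ne0),\qquad g(0,x,y)=\begin{cases}(1-x)y, & y\le x,\\ x(1-y), & x<y.\end{cases}$$ Then the problem $$\frac{\partial u}{\partial t}-\frac{\partial^2u}{\partial x^2}=F\ \ (0<x<1,\ t>0),\qquad u(0,t)=u(1,t)=0\ \ (t>0),\qquad u(x,0)=0\ \ (x\in I)$$ has exactly one bounded solution $u_2:I\times[0,\infty)\to\mathbb R$ with $u_2$, $\frac{\partial u_2}{\partial t}$, $\frac{\partial^2u_2}{\partial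 x^2}$ continuous on $I\times[0,\infty)$, and for all $x\in I$ and $t\ge0$ $$u_2(x,t)=\mathrm{P.V.}\,\frac1{2\pi}\int_0^t\int_{-\infty}^{\infty}\int_0^1e^{ir(t-s)}\,g(\sqrt{ir},x,y)\,F(y,s)\,dy\,dr\,ds .$$ Here $\sqrt{ir}$ is either square root of $ir$ ($g$ is even in $m$), and the principal value means that $\int_{-\infty}^\infty dr$ is $\lim_{M\to\infty}\int_{-M}^{M}dr$; the identity holds both with this limit taken outside the integral in $s$ (the truncated triple integrals being absolutely convergent) and with it taken inside, where it exists for every $s\in[0,t)$ and is integrable in $s$ over $[0,t]$. -/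

import Mathlib

open Set Filter Topology MeasureTheory

noncomputable section

namespace HeatDirichlet

/-- The closed space-time domain `[0,1] × [0,∞)`; points are pairs `(x, t)`. -/
def domain : Set (ℝ × ℝ) := Icc (0 : ℝ) 1 ×ˢ Ici (0 : ℝ)

/-- `Gx` is the partial derivative in `x` of `G` on `[0,1] × [0,∞)`
(one-sided at `x = 0` and `x = 1`). -/
def HasPartialX (G Gx : ℝ → ℝ → ℝ) : Prop :=
  ∀ x ∈ Icc (0 : ℝ) 1, ∀ t ∈ Ici (0 : ℝ),
    HasDerivWithinAt (fun z => G z t) (Gx x t) (Icc 0 1) x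

/-- `Gt` is the partial derivative in `t` of `G` on `[0,1] × [0,∞)` (one-sided at `t = 0`). -/
def HasPartialT (G Gt : ℝ → ℝ → ℝ) : Prop :=
  ∀ x ∈ Icc (0 : ℝ) 1, ∀ t ∈ Ici (0 : ℝ),
    HasDerivWithinAt (fun τ => G x τ) (Gt x t) (Ici 0) t

/-- `G` is continuous on `[0,1] × [0,∞)`, jointly in `(x, t)`. -/
def IsCont (G : ℝ → ℝ → ℝ) : Prop :=
  ContinuousOn (fun p : ℝ × ℝ => G p.1 p.2) domain

/-- `G` is bounded on `[0,1] × [0,∞)`. -/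
def IsBdd (G : ℝ → ℝ → ℝ) : Prop :=
  ∃ C : ℝ, ∀ x ∈ Icc (0 : ℝ) 1, ∀ t ∈ Ici (0 : ℝ), |G x t| ≤ C

/-- `u` is a bounded solution, with `u`, `u_t`, `u_xx` continuous on `[0,1] × [0,∞)`, of
`u_t - u_xx = F` for `0 < x < 1`, `t > 0`, with `u(0,t) = u(1,t) = 0` for `t > 0` and
`u(x,0) = f(x)` for `x ∈ [0,1]`. Only the values on `[0,1] × [0,∞)` matter. -/
def IsBoundedSolution (F : ℝ → ℝ → ℝ) (f : ℝ → ℝ) (u : ℝ → ℝ → ℝ) : Prop :=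
  (∃ ut ux uxx : ℝ → ℝ → ℝ,
    HasPartialT u ut ∧ HasPartialX u ux ∧ HasPartialX ux uxx ∧
    IsCont u ∧ IsCont ut ∧ IsCont uxx ∧
    ∀ x ∈ Ioo (0 : ℝ) 1, ∀ t ∈ Ioi (0 : ℝ), ut x t - uxx x t = F x t) ∧
  (∀ t ∈ Ioi (0 : ℝ), u 0 t = 0 ∧ u 1 t = 0) ∧
  (∀ x ∈ Icc (0 : ℝ) 1, u x 0 = f x) ∧
  IsBdd u

/-- The Green's function of `-v'' + m² v = h`, `v(0) = v(1) = 0`, for complex `m`. -/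
def green (m : ℂ) (x y : ℝ) : ℂ :=
  if m = 0 then
    if y ≤ x then (1 - (x : ℂ)) * y else x * (1 - (y : ℂ))
  else
    -1 / (m * Complex.sinh m) *
      (if y ≤ x then Complex.sinh (m * (x - 1)) * Complex.sinh (m * y)
       else Complex.sinh (m * x) * Complex.sinh (m * (y - 1)))

/-- The principal square root of `i r`. The function `green` is even in `m`, so that the other
root would give the same values. -/
def sqrtI (r : ℝ) : ℂ := (Complex.I * (r : ℂ)) ^ (1 / 2 : ℂ)

/-- The integrand `e^{i r (t - s)} g(√(i r), x, y) F(y, s)`. -/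
def integrand (F : ℝ → ℝ → ℝ) (x t s r y : ℝ) : ℂ :=
  Complex.exp (Complex.I * r * (t - s)) * green (sqrtI r) x y * (F y s : ℂ)

/-- The principal value integral `P.V. ∫_{-∞}^{∞} h(r) dr` exists and equals `L`. -/
def HasPVIntegral (h : ℝ → ℂ) (L : ℂ) : Prop :=
  (∀ M : ℝ, IntervalIntegrable h volume (-M) M) ∧
  Tendsto (fun M : ℝ => ∫ r in (-M)..M, h r) atTop (𝓝 L)

end HeatDirichlet

end

/-! Everything is diagonal in the Dirichlet eigenfunctions sin(λₙx), λₙ = (n+1)π. Two integrations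
by parts, using F = 0 at the endpoints, make the sine coefficients bₙ(s) of F(·,s) of size O(λₙ⁻²),
locally uniformly in s. The candidate solution is u = Σ 2 sin(λₙx) cₙ(t), with cₙ' + λₙ²cₙ = bₙ and
cₙ(0) = 0. Since λₙ²∫₀ᵗ exp(-λₙ²(t-s)) ds ≤ 1, the numbers λₙ²cₙ decay like bₙ, so the series may be
differentiated once in t and twice in x (`RegularCoeff.isBoundedSolution`). Conversely, the sine
coefficients of any solution satisfy the same initial value problems, which gives uniqueness
(`IsBoundedSolution.eq_modeSeries`).

For the integral formula, the Green's function is the resolvent kernel, so integrating it against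
sin(λₙy) divides the sine by λₙ² + ir (`integral_green_mul_sin`). The truncated r-integral thus
becomes a series in `truncInv`, the integral of exp(irτ)/(l+ir) over [-M,M] with l = λₙ² and τ =
t-s. It tends to 2π exp(-lτ) for τ > 0 (`tendsto_truncInv`). Its convergence is only conditional, so
the decisive point is a bound independent of l, τ and M (`norm_truncInv_le`); it comes from
rewriting the integral through the bounded function Si(x) = ∫₀ˣ sin y / y dy. With this bound and Σ
λₙ⁻² < ∞, dominated convergence applies both in the sum over n and in the integral over s, and both
readings of the principal value give Duhamel's formula for u. -/

noncomputable section

namespace HeatDirichlet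

/-! ### Sine series on [0,1] -/

/-- The frequencies `(n + 1) π` of the Dirichlet eigenfunctions. -/
def freq (n : ℕ) : ℝ := ((n : ℝ) + 1) * Real.pi

/-- The sine coefficients `∫₀¹ sin((n + 1) π y) G(y) dy`. -/
def sineCoeff (G : ℝ → ℝ) (n : ℕ) : ℝ := ∫ y in (0 : ℝ)..1, Real.sin (freq n * y) * G y

lemma freq_pos (n : ℕ) : 0 < freq n := by unfold freq; positivity

lemma sin_freq (n : ℕ) : Real.sin (freq n) = 0 := by
  have := Real.sin_nat_mul_pi (n + 1)
  push_cast at this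
  exact this

lemma summable_inv_freq_sq : Summable fun n => 1 / freq n ^ 2 := by
  have h := (summable_nat_add_iff 1).2 (Real.summable_one_div_nat_pow.2 one_lt_two)
  refine (h.mul_left (1 / Real.pi ^ 2)).congr fun n => ?_
  simp only [freq, Nat.cast_add, Nat.cast_one]
  field_simp

lemma abs_sineCoeff_le {G : ℝ → ℝ} {K : ℝ} (hG : ∀ x ∈ Icc (0 : ℝ) 1, |G x| ≤ K) (n : ℕ) :
    |sineCoeff G n| ≤ K := by
  have := intervalIntegral.norm_integral_le_of_norm_le_const (a := 0) (b := 1) (C := K)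
    (f := fun y => Real.sin (freq n * y) * G y) (fun y hy => by
      rw [uIoc_of_le zero_le_one] at hy
      rw [norm_mul, Real.norm_eq_abs, Real.norm_eq_abs]
      calc _ ≤ 1 * |G y| := by gcongr; exact Real.abs_sin_le_one _
        _ ≤ K := by rw [one_mul]; exact hG y ⟨hy.1.le, hy.2⟩)
  simpa [sineCoeff] using this

/-- Equality on the open interval is enough because endpoints are null; the differential equation is
available only there. -/
lemma sineCoeff_congr {G H : ℝ → ℝ} (h : ∀ x ∈ Ioo (0 : ℝ) 1, G x = H x) (n : ℕ) :
    sineCoeff G n = sineCoeff H n := by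
  refine intervalIntegral.integral_congr_ae ?_
  have : ∀ᵐ y : ℝ, y ≠ 1 := by simp [ae_iff]
  filter_upwards [this] with y hy1 hy
  rw [uIoc_of_le zero_le_one] at hy
  rw [h y ⟨hy.1, lt_of_le_of_ne hy.2 hy1⟩]

lemma freq_sq_mul_sineCoeff {G Gx Gxx : ℝ → ℝ}
    (hG : ∀ x ∈ Icc (0 : ℝ) 1, HasDerivWithinAt G (Gx x) (Icc 0 1) x)
    (hGx : ∀ x ∈ Icc (0 : ℝ) 1, HasDerivWithinAt Gx (Gxx x) (Icc 0 1) x)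
    (hGxx : ContinuousOn Gxx (Icc 0 1)) (h0 : G 0 = 0) (h1 : G 1 = 0) (n : ℕ) :
    freq n ^ 2 * sineCoeff G n = - sineCoeff Gxx n := by
  have cG : ContinuousOn G (Icc 0 1) := fun x hx => (hG x hx).continuousWithinAt
  have cGx : ContinuousOn Gx (Icc 0 1) := fun x hx => (hGx x hx).continuousWithinAt
  have csin : Continuous fun y => Real.sin (freq n * y) := by fun_prop
  have ccos : Continuous fun y => Real.cos (freq n * y) := by fun_prop
  have i1 : IntervalIntegrable (fun y => Real.sin (freq n * y) * Gxx y) volume 0 1 :=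
    (csin.continuousOn.mul hGxx).intervalIntegrable_of_Icc zero_le_one
  have i2 : IntervalIntegrable (fun y => freq n ^ 2 * (Real.sin (freq n * y) * G y)) volume 0 1 :=
    (continuousOn_const.mul (csin.continuousOn.mul cG)).intervalIntegrable_of_Icc zero_le_one
  have key := intervalIntegral.integral_eq_sub_of_hasDerivAt_of_le (a := 0) (b := 1)
    (f := fun y => Real.sin (freq n * y) * Gx y - freq n * Real.cos (freq n * y) * G y)
    (f' := fun y => Real.sin (freq n * y) * Gxx y + freq n ^ 2 * (Real.sin (freq n * y) * G y))
    zero_le_one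
    ((csin.continuousOn.mul cGx).sub ((continuousOn_const.mul ccos.continuousOn).mul cG))
    (fun y hy => by
      have hn : Icc (0 : ℝ) 1 ∈ 𝓝 y := Icc_mem_nhds hy.1 hy.2
      have d1 := (hG y (Ioo_subset_Icc_self hy)).hasDerivAt hn
      have d2 := (hGx y (Ioo_subset_Icc_self hy)).hasDerivAt hn
      have dl : HasDerivAt (fun y => freq n * y) (freq n) y := by
        simpa using (hasDerivAt_id y).const_mul (freq n)
      exact ((dl.sin.mul d2).sub ((dl.cos.const_mul (freq n)).mul d1)).congr_deriv (by ring))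
    (i1.add i2)
  rw [intervalIntegral.integral_add i1 i2, intervalIntegral.integral_const_mul] at key
  simp only [h0, h1, mul_one, mul_zero, Real.sin_zero, sin_freq, zero_mul, sub_zero] at key
  unfold sineCoeff
  linarith

/-- Because G 0 = 0, the lifted function is the odd 2-periodic extension of G. The maxima keep every
argument in [0,1], where alone G is controlled. -/
lemma fourierCoeff_odd_extension {G : ℝ → ℝ} (hG : ContinuousOn G (Icc 0 1)) (h0 : G 0 = 0)
    [Fact ((0 : ℝ) < 2)] (n : ℤ) :
    fourierCoeff (AddCircle.liftIco 2 (-1)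
      (fun x : ℝ => ((G (max x 0) - G (max (-x) 0) : ℝ) : ℂ))) n =
      -Complex.I * ((∫ y in (0 : ℝ)..1, Real.sin (n * Real.pi * y) * G y : ℝ) : ℂ) := by
  have hp : ContinuousOn (fun x : ℝ => G (max x 0)) (Icc (-1) 1) :=
    hG.comp (by fun_prop) fun x hx => ⟨le_max_right _ _, max_le hx.2 zero_le_one⟩
  have hm : ContinuousOn (fun x : ℝ => G (max (-x) 0)) (Icc (-1) 1) :=
    hG.comp (by fun_prop) fun x hx => ⟨le_max_right _ _, max_le (by linarith [hx.1]) zero_le_one⟩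
  let e : ℝ → ℂ := fun x => Complex.exp (-(Complex.I * n * Real.pi * x))
  have he : Continuous e := by fun_prop
  have hc : ContinuousOn (fun x : ℝ => e x * ((G (max x 0) - G (max (-x) 0) : ℝ) : ℂ))
      (Icc (-1) 1) :=
    he.continuousOn.mul (Complex.continuous_ofReal.comp_continuousOn (hp.sub hm))
  have i1 : IntervalIntegrable (fun x : ℝ => e x * ((G (max x 0) - G (max (-x) 0) : ℝ) : ℂ))
      volume (-1) 0 :=
    (hc.mono (Icc_subset_Icc_right zero_le_one)).intervalIntegrable_of_Icc (by norm_num)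
  have i2 : IntervalIntegrable (fun x : ℝ => e x * ((G (max x 0) - G (max (-x) 0) : ℝ) : ℂ))
      volume 0 1 :=
    (hc.mono (Icc_subset_Icc_left (by norm_num))).intervalIntegrable_of_Icc (by norm_num)
  have j1 : IntervalIntegrable (fun x : ℝ => e x * (G x : ℂ)) volume 0 1 :=
    (he.continuousOn.mul (Complex.continuous_ofReal.comp_continuousOn hG)).intervalIntegrable_of_Icc
      zero_le_one
  have j2 : IntervalIntegrable (fun x : ℝ => e (-x) * (G x : ℂ)) volume 0 1 :=
    ((he.comp continuous_neg).continuousOn.mul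
      (Complex.continuous_ofReal.comp_continuousOn hG)).intervalIntegrable_of_Icc zero_le_one
  have k1 : ∫ x in (-1 : ℝ)..0, e x * ((G (max x 0) - G (max (-x) 0) : ℝ) : ℂ) =
      -∫ x in (0 : ℝ)..1, e (-x) * (G x : ℂ) := by
    have := intervalIntegral.integral_comp_neg (a := 0) (b := 1)
      (fun x : ℝ => e x * ((G (max x 0) - G (max (-x) 0) : ℝ) : ℂ))
    rw [neg_zero] at this
    rw [← this, ← intervalIntegral.integral_neg]
    refine intervalIntegral.integral_congr fun x hx => ?_
    rw [uIcc_of_le zero_le_one] at hx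
    simp [max_eq_left hx.1, max_eq_right (neg_nonpos.2 hx.1), h0]
  have k2 : ∫ x in (0 : ℝ)..1, e x * ((G (max x 0) - G (max (-x) 0) : ℝ) : ℂ) =
      ∫ x in (0 : ℝ)..1, e x * (G x : ℂ) := by
    refine intervalIntegral.integral_congr fun x hx => ?_
    rw [uIcc_of_le zero_le_one] at hx
    simp [max_eq_left hx.1, max_eq_right (neg_nonpos.2 hx.1), h0]
  rw [fourierCoeff_liftIco_eq, fourierCoeffOn_eq_integral]
  have hint : ∀ x : ℝ, (fourier (-n) : C(AddCircle (-1 + 2 - -1 : ℝ), ℂ)) x •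
      ((G (max x 0) - G (max (-x) 0) : ℝ) : ℂ) =
      e x * ((G (max x 0) - G (max (-x) 0) : ℝ) : ℂ) := fun x => by
    rw [fourier_coe_apply, smul_eq_mul]
    congr 2
    push_cast
    ring_nf
  simp only [hint]
  rw [show (-1 + 2 : ℝ) = 1 by norm_num,
    ← intervalIntegral.integral_add_adjacent_intervals i1 i2, k1, k2, neg_add_eq_sub,
    ← intervalIntegral.integral_sub j1 j2, ← intervalIntegral.integral_ofReal,
    ← intervalIntegral.integral_const_mul, ← intervalIntegral.integral_smul]
  refine intervalIntegral.integral_congr fun x _ => ?_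
  simp only [e, Complex.real_smul]
  push_cast
  rw [Complex.sin]
  ring_nf
  simp
  ring

/-- A continuous function that vanishes at `0` and `1` is the sum of its sine series if the
coefficients are summable. -/
lemma hasSum_sine_series {G : ℝ → ℝ} (hG : ContinuousOn G (Icc 0 1)) (h0 : G 0 = 0)
    (h1 : G 1 = 0) (hs : Summable (sineCoeff G)) {x : ℝ} (hx : x ∈ Icc (0 : ℝ) 1) :
    HasSum (fun n => 2 * sineCoeff G n * Real.sin (freq n * x)) (G x) := by
  have : Fact ((0 : ℝ) < 2) := ⟨two_pos⟩
  let f : ℝ → ℂ := fun x => ((G (max x 0) - G (max (-x) 0) : ℝ) : ℂ)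
  have hf : Continuous (AddCircle.liftIco 2 (-1) f) := by
    refine AddCircle.liftIco_continuous ?_ ?_
    · norm_num [f, h0, h1]
    · rw [show (-1 + 2 : ℝ) = 1 by norm_num]
      refine Complex.continuous_ofReal.comp_continuousOn (ContinuousOn.sub ?_ ?_)
      · exact hG.comp (by fun_prop) fun x hx => ⟨le_max_right _ _, max_le hx.2 zero_le_one⟩
      · exact hG.comp (by fun_prop)
          fun x hx => ⟨le_max_right _ _, max_le (by linarith [hx.1]) zero_le_one⟩
  have hco : ∀ n : ℤ, fourierCoeff (AddCircle.liftIco 2 (-1) f) n =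
      -Complex.I * ((∫ y in (0 : ℝ)..1, Real.sin (n * Real.pi * y) * G y : ℝ) : ℂ) :=
    fourierCoeff_odd_extension hG h0
  have hcp : ∀ n : ℕ, fourierCoeff (AddCircle.liftIco 2 (-1) f) ((n : ℤ) + 1) =
      -Complex.I * (sineCoeff G n : ℂ) := fun n => by
    rw [hco]; push_cast; rfl
  have hcm : ∀ n : ℕ, fourierCoeff (AddCircle.liftIco 2 (-1) f) (-((n : ℤ) + 1)) =
      Complex.I * (sineCoeff G n : ℂ) := fun n => by
    have : ∫ y in (0 : ℝ)..1, Real.sin ((-((n : ℤ) + 1) : ℤ) * Real.pi * y) * G y =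
        -sineCoeff G n := by
      rw [sineCoeff, ← intervalIntegral.integral_neg]
      refine intervalIntegral.integral_congr fun y _ => ?_
      simp only [freq]
      push_cast
      rw [show -((n : ℝ) + 1) * Real.pi * y = -(((n : ℝ) + 1) * Real.pi * y) by ring,
        Real.sin_neg]
      ring
    rw [hco, this]
    push_cast
    ring
  have hc0 : fourierCoeff (AddCircle.liftIco 2 (-1) f) 0 = 0 := by
    rw [hco]; simp
  have hsC : Summable fun n => (sineCoeff G n : ℂ) := Complex.summable_ofReal.2 hs
  have hsum : Summable (fourierCoeff (AddCircle.liftIco 2 (-1) f)) :=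
    (HasSum.of_add_one_of_neg_add_one
      ((hsC.mul_left (-Complex.I)).congr fun n => (hcp n).symm).hasSum
      ((hsC.mul_left Complex.I).congr fun n => (hcm n).symm).hasSum).summable
  obtain ⟨x0, x1⟩ := hx
  -- `liftIco` represents the circle by [-1,1), so x = 1 is treated apart; there every term and G
  -- itself vanish.
  rcases eq_or_lt_of_le x1 with rfl | x1
  · simp [sin_freq, h1, hasSum_zero]
  have key := (has_pointwise_sum_fourier_series_of_summable
    (f := (⟨AddCircle.liftIco 2 (-1) f, hf⟩ : C(AddCircle (2 : ℝ), ℂ))) hsum (x : AddCircle (2:ℝ)))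
  simp only [ContinuousMap.coe_mk] at key
  rw [AddCircle.liftIco_coe_apply ⟨by linarith, by linarith⟩] at key
  -- Pairing n with -n counts the index 0 twice; this is harmless since that coefficient is zero,
  -- and the index is then shifted to start at 1.
  have key2 := key.nat_add_neg
  rw [← hasSum_nat_add_iff' 1] at key2
  have hfx : f x = (G x : ℂ) := by
    simp [f, max_eq_left x0, max_eq_right (neg_nonpos.2 x0), h0]
  simp only [Nat.cast_add, Nat.cast_one, hcp, hcm, Finset.range_one, Finset.sum_singleton,
    Nat.cast_zero, neg_zero, hc0, zero_smul, add_zero, sub_zero, hfx] at key2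
  rw [← Complex.hasSum_ofReal]
  refine key2.congr_fun fun n => ?_
  rw [fourier_coe_apply, fourier_coe_apply, freq]
  push_cast
  rw [Complex.sin]
  simp only [smul_eq_mul]
  ring_nf

/-! ### The Dirichlet integral, with rate and uniform bound -/

/-- The sine integral `∫₀ˣ sin y / y dy`. -/
def sineIntegral (x : ℝ) : ℝ := ∫ y in (0 : ℝ)..x, Real.sinc y

lemma continuous_sineIntegral : Continuous sineIntegral :=
  intervalIntegral.continuous_primitive (fun a b => Real.continuous_sinc.intervalIntegrable a b) 0

lemma hasDerivAt_sineIntegral (x : ℝ) : HasDerivAt sineIntegral (Real.sinc x) x :=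
  intervalIntegral.integral_hasDerivAt_right (Real.continuous_sinc.intervalIntegrable _ _)
    Real.continuous_sinc.stronglyMeasurable.stronglyMeasurableAtFilter
    Real.continuous_sinc.continuousAt

lemma integral_exp_neg_mul_sin (u X : ℝ) :
    ∫ y in (0 : ℝ)..X, Real.exp (-u * y) * Real.sin y =
      (1 + u ^ 2)⁻¹ - Real.exp (-u * X) * (Real.cos X + u * Real.sin X) / (1 + u ^ 2) := by
  have hu : (1 + u ^ 2) ≠ 0 := by positivity
  rw [intervalIntegral.integral_eq_sub_of_hasDerivAt
    (f := fun y => -(Real.exp (-u * y) * (Real.cos y + u * Real.sin y) / (1 + u ^ 2)))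
    (fun y _ => ?_) (Continuous.intervalIntegrable (by fun_prop) _ _)]
  · simp; ring
  · have dl : HasDerivAt (fun y => -u * y) (-u) y := by
      simpa using (hasDerivAt_id y).const_mul (-u)
    have := ((dl.exp.mul ((Real.hasDerivAt_cos y).add
      ((Real.hasDerivAt_sin y).const_mul u))).div_const (1 + u ^ 2)).neg
    refine this.congr_deriv ?_
    simp only [Pi.add_apply]
    field_simp
    ring

lemma integral_exp_neg_mul_Ioi {y : ℝ} (hy : 0 < y) :
    IntegrableOn (fun u : ℝ => Real.exp (-u * y)) (Ioi 0) ∧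
      ∫ u in Ioi (0 : ℝ), Real.exp (-u * y) = 1 / y := by
  have h := integrableOn_exp_mul_Ioi (neg_neg_of_pos hy) 0
  have h2 := integral_exp_mul_Ioi (neg_neg_of_pos hy) 0
  have e : (fun u : ℝ => Real.exp (-u * y)) = fun u => Real.exp (-y * u) := by
    ext u; ring_nf
  rw [e]
  refine ⟨h, ?_⟩
  rw [h2]
  simp

/-- Write 1/y = ∫₀^∞ exp(-uy) du and exchange the integrals. On (0,X] × (0,∞) Fubini applies because
the inner integral of the absolute value is |sin y|/y ≤ 1. -/
lemma sineIntegral_eq {X : ℝ} (hX : 0 < X) :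
    IntegrableOn (fun u : ℝ => Real.exp (-u * X) * (Real.cos X + u * Real.sin X) / (1 + u ^ 2))
      (Ioi 0) ∧
    sineIntegral X = Real.pi / 2 -
      ∫ u in Ioi (0 : ℝ), Real.exp (-u * X) * (Real.cos X + u * Real.sin X) / (1 + u ^ 2) := by
  let f : ℝ → ℝ → ℝ := fun y u => Real.exp (-u * y) * Real.sin y
  have hmeas : AEStronglyMeasurable (Function.uncurry f)
      ((volume.restrict (uIoc 0 X)).prod (volume.restrict (Ioi 0))) := by
    apply Continuous.aestronglyMeasurable
    simp only [f, Function.uncurry_def]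
    fun_prop
  have hint : Integrable (Function.uncurry f)
      ((volume.restrict (uIoc 0 X)).prod (volume.restrict (Ioi 0))) := by
    rw [uIoc_of_le hX.le] at hmeas ⊢
    refine (integrable_prod_iff hmeas).2 ⟨?_, ?_⟩
    · filter_upwards [ae_restrict_mem measurableSet_Ioc] with y hy
      change Integrable (fun u => Real.exp (-u * y) * Real.sin y) _
      exact (integral_exp_neg_mul_Ioi hy.1).1.mul_const _
    · have hb : Integrable (fun _ : ℝ => (1 : ℝ)) (volume.restrict (Ioc 0 X)) :=
        integrable_const _
      refine hb.mono hmeas.norm.integral_prod_right' ?_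
      filter_upwards [ae_restrict_mem measurableSet_Ioc] with y hy
      have : ∀ u, ‖Function.uncurry f (y, u)‖ = Real.exp (-u * y) * |Real.sin y| := fun u => by
        simp [f]
      simp only [this]
      rw [integral_mul_const, (integral_exp_neg_mul_Ioi hy.1).2, norm_one, Real.norm_eq_abs,
        abs_mul, abs_abs, abs_of_pos (one_div_pos.2 hy.1), one_div, ← div_eq_inv_mul,
        div_le_one hy.1]
      exact (Real.abs_sin_le_abs).trans (abs_of_pos hy.1).le
  have hswap := intervalIntegral_integral_swap hint
  have hL : ∫ y in (0 : ℝ)..X, ∫ u in Ioi (0 : ℝ), f y u = sineIntegral X := by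
    refine intervalIntegral.integral_congr_ae (Eventually.of_forall fun y hy => ?_)
    rw [uIoc_of_le hX.le] at hy
    simp only [f]
    rw [integral_mul_const, (integral_exp_neg_mul_Ioi hy.1).2, Real.sinc_of_ne_zero hy.1.ne']
    ring
  have hR : ∀ u, ∫ y in (0 : ℝ)..X, f y u =
      (1 + u ^ 2)⁻¹ - Real.exp (-u * X) * (Real.cos X + u * Real.sin X) / (1 + u ^ 2) :=
    fun u => integral_exp_neg_mul_sin u X
  have hi1 : IntegrableOn (fun u : ℝ => (1 + u ^ 2)⁻¹) (Ioi 0) :=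
    integrable_inv_one_add_sq.integrableOn
  have hi2 : IntegrableOn
      (fun u : ℝ => Real.exp (-u * X) * (Real.cos X + u * Real.sin X) / (1 + u ^ 2)) (Ioi 0) := by
    have h3 := hint.integral_prod_right
    have h4 : Integrable (fun u => ∫ y in (0 : ℝ)..X, f y u) (volume.restrict (Ioi 0)) := by
      simp only [intervalIntegral.integral_of_le hX.le]
      rw [uIoc_of_le hX.le] at h3
      exact h3
    simp only [hR] at h4
    refine (hi1.sub h4).congr (Eventually.of_forall fun u => ?_)
    simp
  refine ⟨hi2, ?_⟩
  rw [hL] at hswap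
  simp only [hR] at hswap
  rw [integral_sub hi1 hi2, integral_Ioi_inv_one_add_sq, Real.arctan_zero, sub_zero] at hswap
  exact hswap

lemma abs_sineIntegral_sub_le {X : ℝ} (hX : 0 < X) :
    |sineIntegral X - Real.pi / 2| ≤ 2 / X := by
  obtain ⟨hi, he⟩ := sineIntegral_eq hX
  obtain ⟨hj, hje⟩ := integral_exp_neg_mul_Ioi hX
  rw [he, sub_sub_cancel_left, abs_neg]
  calc |∫ u in Ioi (0 : ℝ), Real.exp (-u * X) * (Real.cos X + u * Real.sin X) / (1 + u ^ 2)|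
      ≤ ∫ u in Ioi (0 : ℝ), 2 * Real.exp (-u * X) := by
        rw [← Real.norm_eq_abs]
        refine norm_integral_le_of_norm_le (hj.const_mul 2) (Eventually.of_forall fun u => ?_)
        rw [norm_div, norm_mul, Real.norm_eq_abs, Real.norm_eq_abs, Real.norm_eq_abs,
          Real.abs_exp, abs_of_pos (by positivity : (0 : ℝ) < 1 + u ^ 2),
          div_le_iff₀ (by positivity)]
        have h1 : |Real.cos X + u * Real.sin X| ≤ 1 + |u| := by
          refine (abs_add_le _ _).trans (add_le_add (Real.abs_cos_le_one _) ?_)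
          rw [abs_mul]
          exact mul_le_of_le_one_right (abs_nonneg _) (Real.abs_sin_le_one _)
        have h2 : 1 + |u| ≤ 2 * (1 + u ^ 2) := by
          rw [← sq_abs]; nlinarith [sq_nonneg (|u| - 1), abs_nonneg u]
        calc _ ≤ Real.exp (-u * X) * (2 * (1 + u ^ 2)) := by gcongr; exact h1.trans h2
          _ = _ := by ring
    _ = 2 / X := by rw [integral_const_mul, hje]; ring

lemma tendsto_sineIntegral : Tendsto sineIntegral atTop (𝓝 (Real.pi / 2)) := by
  rw [tendsto_iff_norm_sub_tendsto_zero]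
  refine squeeze_zero' (Eventually.of_forall fun _ => norm_nonneg _) ?_
    ((tendsto_const_nhds (x := (2 : ℝ))).div_atTop tendsto_id)
  filter_upwards [eventually_gt_atTop 0] with X hX
  exact abs_sineIntegral_sub_le hX

lemma abs_sineIntegral_le {X : ℝ} (hX : 0 ≤ X) : |sineIntegral X| ≤ 4 := by
  rcases le_or_gt X 1 with h | h
  · have := intervalIntegral.norm_integral_le_of_norm_le_const (a := 0) (b := X) (C := 1)
      (f := Real.sinc) (fun y _ => Real.abs_sinc_le_one y)
    rw [sub_zero, abs_of_nonneg hX, one_mul] at this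
    exact this.trans (by linarith)
  · have h1 := abs_sineIntegral_sub_le (zero_lt_one.trans h)
    have h2 : 2 / X ≤ 2 := by rw [div_le_iff₀ (by linarith)]; linarith
    have h3 := abs_add_le (sineIntegral X - Real.pi / 2) (Real.pi / 2)
    rw [sub_add_cancel, abs_of_pos (by positivity : (0 : ℝ) < Real.pi / 2)] at h3
    linarith [Real.pi_lt_four]

/-! ### Truncated Fourier inversion of 1/(l + ir) -/

/-- The truncated inverse Fourier transform `∫_{-M}^{M} e^{i r τ} / (l + i r) dr`. -/
def truncInv (l τ M : ℝ) : ℂ :=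
  ∫ r in (-M)..M, Complex.exp (Complex.I * r * τ) / (l + Complex.I * r)

lemma add_I_mul_ne_zero {l : ℝ} (hl : 0 < l) (r : ℝ) : (l : ℂ) + Complex.I * r ≠ 0 := by
  intro h
  have := congrArg Complex.re h
  simp at this
  exact hl.ne' this

lemma continuous_truncInv {l : ℝ} (hl : 0 < l) (M : ℝ) : Continuous fun τ => truncInv l τ M := by
  refine intervalIntegral.continuous_parametric_intervalIntegral_of_continuous' ?_ _ _
  simp only [Function.uncurry_def]
  exact Continuous.div (by fun_prop) (by fun_prop) fun p => add_I_mul_ne_zero hl _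

lemma truncInv_zero {l : ℝ} (hl : 0 < l) (M : ℝ) :
    truncInv l 0 M = ((2 * Real.arctan (M / l) : ℝ) : ℂ) := by
  have hc : Continuous fun r : ℝ => 1 / ((l : ℂ) + Complex.I * r) :=
    continuous_const.div (by fun_prop) fun r => add_I_mul_ne_zero hl r
  have h1 : truncInv l 0 M = ∫ r in (-M)..M, 1 / ((l : ℂ) + Complex.I * r) := by
    simp [truncInv]
  -- Averaging the integrand over r and -r leaves its real part l/(l² + r²), the derivative of
  -- arctan(r/l).
  have h2 : ∫ r in (-M)..M, 1 / ((l : ℂ) + Complex.I * r) =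
      ∫ r in (-M)..M, 1 / ((l : ℂ) + Complex.I * (-r : ℝ)) := by
    rw [intervalIntegral.integral_comp_neg (fun r : ℝ => 1 / ((l : ℂ) + Complex.I * r)), neg_neg]
  have h3 : ∫ r in (-M)..M, l / (l ^ 2 + r ^ 2) = 2 * Real.arctan (M / l) := by
    have : ∀ r ∈ uIcc (-M) M, HasDerivAt (fun r => Real.arctan (r / l)) (l / (l ^ 2 + r ^ 2)) r :=
      fun r _ => by
        refine ((hasDerivAt_id r).div_const l).arctan.congr_deriv ?_
        simp only [id]
        field_simp
    rw [intervalIntegral.integral_eq_sub_of_hasDerivAt this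
      (Continuous.intervalIntegrable (Continuous.div (by fun_prop) (by fun_prop)
        fun r => by positivity) _ _), neg_div, Real.arctan_neg]
    ring
  have h4 : (2 : ℂ) * truncInv l 0 M = ∫ r in (-M)..M, (2 : ℂ) * ((l / (l ^ 2 + r ^ 2) : ℝ) : ℂ) := by
    have hsum : (2 : ℂ) * truncInv l 0 M = (∫ r in (-M)..M, 1 / ((l : ℂ) + Complex.I * r)) +
        ∫ r in (-M)..M, 1 / ((l : ℂ) + Complex.I * (-r : ℝ)) := by
      rw [← h2, ← h1, two_mul]
    rw [hsum, ← intervalIntegral.integral_add]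
    · refine intervalIntegral.integral_congr fun r _ => ?_
      have a1 := add_I_mul_ne_zero hl r
      have a2 := add_I_mul_ne_zero hl (-r)
      have a3 : (l : ℂ) ^ 2 + r ^ 2 = ((l : ℂ) + Complex.I * r) * (l + Complex.I * (-r : ℝ)) := by
        push_cast
        linear_combination ((r : ℂ) ^ 2) * Complex.I_sq
      push_cast at a2 a3 ⊢
      rw [mul_neg, ← sub_eq_add_neg] at a2 a3
      rw [mul_neg, ← sub_eq_add_neg]
      rw [a3]
      field_simp
      ring
    · exact hc.intervalIntegrable _ _
    · exact (hc.comp continuous_neg).intervalIntegrable _ _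
  rw [intervalIntegral.integral_const_mul, intervalIntegral.integral_ofReal, h3] at h4
  exact mul_left_cancel₀ two_ne_zero h4

lemma integral_exp_I_mul (M σ : ℝ) :
    ∫ r in (-M)..M, Complex.exp (Complex.I * r * σ) = ((2 * (M * Real.sinc (M * σ)) : ℝ) : ℂ) := by
  rcases eq_or_ne M 0 with rfl | hM
  · simp
  have h := integral_exp_mul_I_eq_sinc (M * σ)
  rcases eq_or_ne σ 0 with rfl | hσ
  · simp; ring
  have h2 := intervalIntegral.integral_comp_mul_right (a := -M) (b := M)
    (fun t : ℝ => Complex.exp (t * Complex.I)) hσ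
  have e : ∀ r : ℝ, Complex.exp (Complex.I * r * σ) = Complex.exp (((r * σ : ℝ) : ℂ) * Complex.I) :=
    fun r => by push_cast; ring_nf
  simp only [e]
  rw [h2, neg_mul, h]
  rw [Complex.real_smul]
  push_cast
  have : (σ : ℂ) ≠ 0 := by exact_mod_cast hσ
  field_simp

/-- With z = l + ir, exp(zτ)/z = 1/z + ∫₀^τ exp(zσ) dσ. After exchanging the integrals, the
r-integral is a Dirichlet kernel. -/
lemma exp_mul_truncInv {l : ℝ} (hl : 0 < l) (τ M : ℝ) :
    (Real.exp (l * τ) : ℂ) * truncInv l τ M = ((2 * Real.arctan (M / l) +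
      ∫ σ in (0 : ℝ)..τ, Real.exp (l * σ) * (2 * (M * Real.sinc (M * σ))) : ℝ) : ℂ) := by
  have key : ∀ r : ℝ, Complex.exp ((l + Complex.I * r) * τ) / (l + Complex.I * r) =
      1 / (l + Complex.I * r) + ∫ σ in (0 : ℝ)..τ, Complex.exp ((l + Complex.I * r) * σ) := fun r => by
    rw [integral_exp_mul_complex (add_I_mul_ne_zero hl r)]
    simp
    ring
  have c0 : Continuous fun r : ℝ => 1 / ((l : ℂ) + Complex.I * r) :=
    continuous_const.div (by fun_prop) fun r => add_I_mul_ne_zero hl r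
  have c1 : Continuous (Function.uncurry fun r σ : ℝ => Complex.exp (((l : ℂ) + Complex.I * r) * σ)) := by
    simp only [Function.uncurry_def]
    fun_prop
  have c2 : Continuous fun r : ℝ => ∫ σ in (0 : ℝ)..τ, Complex.exp (((l : ℂ) + Complex.I * r) * σ) :=
    intervalIntegral.continuous_parametric_intervalIntegral_of_continuous' c1 _ _
  have hsplit : ∀ r σ : ℝ, Complex.exp (((l : ℂ) + Complex.I * r) * σ) =
      (Real.exp (l * σ) : ℂ) * Complex.exp (Complex.I * r * σ) := fun r σ => by
    push_cast
    rw [← Complex.exp_add]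
    ring_nf
  have h1 : (Real.exp (l * τ) : ℂ) * truncInv l τ M =
      ∫ r in (-M)..M, Complex.exp ((l + Complex.I * r) * τ) / (l + Complex.I * r) := by
    rw [truncInv, ← intervalIntegral.integral_const_mul]
    refine intervalIntegral.integral_congr fun r _ => ?_
    simp only [hsplit]
    ring
  have h0 : ∫ r in (-M)..M, 1 / ((l : ℂ) + Complex.I * r) = ((2 * Real.arctan (M / l) : ℝ) : ℂ) := by
    rw [← truncInv_zero hl]
    simp [truncInv]
  rw [h1]
  simp only [key]
  rw [intervalIntegral.integral_add (c0.intervalIntegrable _ _) (c2.intervalIntegrable _ _), h0,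
    intervalIntegral_intervalIntegral_swap]
  · simp only [hsplit]
    simp only [intervalIntegral.integral_const_mul, integral_exp_I_mul]
    rw [Complex.ofReal_add, ← intervalIntegral.integral_ofReal]
    congr 1
    refine intervalIntegral.integral_congr fun r _ => ?_
    push_cast
    rfl
  · exact (c1.continuousOn.integrableOn_compact (isCompact_uIcc.prod isCompact_uIcc)).mono_set
      (prod_mono uIoc_subset_uIcc uIoc_subset_uIcc)

/-- Integration by parts moves the derivative from Si(Mσ) to the exponential. The factor M,
unbounded in the kernel, survives only inside the bounded function Si. -/
lemma truncInv_eq {l : ℝ} (hl : 0 < l) (τ M : ℝ) :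
    truncInv l τ M = ((Real.exp (-(l * τ)) * (2 * Real.arctan (M / l)) + 2 * sineIntegral (M * τ) -
      2 * ∫ σ in (0 : ℝ)..τ, l * Real.exp (-(l * (τ - σ))) * sineIntegral (M * σ) : ℝ) : ℂ) := by
  have hparts := intervalIntegral.integral_mul_deriv_eq_deriv_mul (a := 0) (b := τ)
    (u := fun σ => Real.exp (l * σ)) (u' := fun σ => Real.exp (l * σ) * l)
    (v := fun σ => 2 * sineIntegral (M * σ)) (v' := fun σ => 2 * (M * Real.sinc (M * σ)))
    (fun σ _ => HasDerivAt.exp (by simpa using (hasDerivAt_id σ).const_mul l))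
    (fun σ _ => by
      have h1 : HasDerivAt (fun σ => M * σ) M σ := by simpa using (hasDerivAt_id σ).const_mul M
      have h2 := ((hasDerivAt_sineIntegral (M * σ)).comp σ h1).const_mul 2
      exact h2.congr_deriv (by ring))
    (Continuous.intervalIntegrable (by fun_prop) _ _)
    (Continuous.intervalIntegrable (by have := Real.continuous_sinc; fun_prop) _ _)
  have h := exp_mul_truncInv hl τ M
  rw [hparts] at h
  have hS0 : sineIntegral (M * 0) = 0 := by simp [sineIntegral]
  have hm : truncInv l τ M = (Real.exp (-(l * τ)) : ℂ) * ((Real.exp (l * τ) : ℂ) * truncInv l τ M) := by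
    rw [← mul_assoc, ← Complex.ofReal_mul, ← Real.exp_add]; simp
  rw [hm, h, ← Complex.ofReal_mul]
  congr 1
  have hi : ∫ σ in (0 : ℝ)..τ, l * Real.exp (-(l * (τ - σ))) * sineIntegral (M * σ) =
      Real.exp (-(l * τ)) * ((1 / 2) * ∫ σ in (0 : ℝ)..τ, Real.exp (l * σ) * l * (2 * sineIntegral (M * σ))) := by
    rw [← intervalIntegral.integral_const_mul, ← intervalIntegral.integral_const_mul]
    refine intervalIntegral.integral_congr fun σ _ => ?_
    rw [show -(l * (τ - σ)) = -(l * τ) + l * σ by ring, Real.exp_add]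
    ring
  rw [hi, hS0]
  have he : Real.exp (-(l * τ)) * Real.exp (l * τ) = 1 := by rw [← Real.exp_add]; simp
  linear_combination (2 * sineIntegral (M * τ)) * he

lemma integral_mul_exp_neg {l : ℝ} (τ : ℝ) :
    ∫ σ in (0 : ℝ)..τ, l * Real.exp (-(l * (τ - σ))) = 1 - Real.exp (-(l * τ)) := by
  rw [intervalIntegral.integral_eq_sub_of_hasDerivAt (f := fun σ => Real.exp (-(l * (τ - σ))))
    (fun σ _ => ?_) (Continuous.intervalIntegrable (by fun_prop) _ _)]
  · simp
  · have : HasDerivAt (fun σ => -(l * (τ - σ))) l σ :=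
      (((hasDerivAt_id σ).const_sub τ).const_mul l).neg.congr_deriv (by simp)
    exact this.exp.congr_deriv (by ring)

/-- The weight l exp(-l(τ-σ)) has mass at most 1 on [0,τ], so nothing depends on l. With |Si| ≤ 4
and |arctan| ≤ 2 the three terms of `truncInv_eq` contribute 4 + 8 + 2·4. -/
lemma norm_truncInv_le {l τ M : ℝ} (hl : 0 < l) (hτ : 0 ≤ τ) (hM : 0 ≤ M) :
    ‖truncInv l τ M‖ ≤ 20 := by
  rw [truncInv_eq hl, Complex.norm_real, Real.norm_eq_abs]
  have h1 : |Real.exp (-(l * τ)) * (2 * Real.arctan (M / l))| ≤ 4 := by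
    have e1 : Real.exp (-(l * τ)) ≤ 1 := Real.exp_le_one_iff.2 (by nlinarith)
    have e2 : |Real.arctan (M / l)| ≤ 2 := by
      rw [abs_le]
      have := Real.neg_pi_div_two_lt_arctan (M / l)
      have := Real.arctan_lt_pi_div_two (M / l)
      constructor <;> linarith [Real.pi_lt_four]
    rw [abs_mul, abs_mul, Real.abs_exp, abs_two]
    nlinarith [abs_nonneg (Real.arctan (M / l)), Real.exp_pos (-(l * τ))]
  have h2 : |2 * sineIntegral (M * τ)| ≤ 8 := by
    rw [abs_mul, abs_two]; linarith [abs_sineIntegral_le (mul_nonneg hM hτ)]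
  have h3 : |∫ σ in (0 : ℝ)..τ, l * Real.exp (-(l * (τ - σ))) * sineIntegral (M * σ)| ≤ 4 := by
    have hb : ∀ σ ∈ Ioc 0 τ, ‖l * Real.exp (-(l * (τ - σ))) * sineIntegral (M * σ)‖ ≤
        4 * (l * Real.exp (-(l * (τ - σ)))) := fun σ hσ => by
      rw [norm_mul, mul_comm, Real.norm_of_nonneg (by positivity : 0 ≤ l * Real.exp (-(l * (τ - σ))))]
      gcongr
      exact abs_sineIntegral_le (mul_nonneg hM hσ.1.le)
    have := intervalIntegral.norm_integral_le_of_norm_le (μ := volume) hτ (Eventually.of_forall hb)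
      (Continuous.intervalIntegrable (by fun_prop) _ _)
    rw [intervalIntegral.integral_const_mul, integral_mul_exp_neg] at this
    rw [Real.norm_eq_abs] at this
    linarith [Real.exp_pos (-(l * τ))]
  rw [abs_le] at *
  constructor <;> linarith [h1.1, h1.2, h2.1, h2.2, h3.1, h3.2]

/-- In `truncInv_eq` both arctan and Si tend to π/2, and π exp(-lτ) + π - π(1 - exp(-lτ)) = 2π
exp(-lτ). At τ = 0 the limit would be π, half the value of this expression. -/
lemma tendsto_truncInv {l τ : ℝ} (hl : 0 < l) (hτ : 0 < τ) :
    Tendsto (truncInv l τ) atTop (𝓝 ((2 * Real.pi * Real.exp (-(l * τ)) : ℝ) : ℂ)) := by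
  have hat : Tendsto (fun M : ℝ => Real.arctan (M / l)) atTop (𝓝 (Real.pi / 2)) :=
    (Real.tendsto_arctan_atTop.mono_right nhdsWithin_le_nhds).comp
      (tendsto_id.atTop_div_const hl)
  have hS : ∀ σ : ℝ, 0 < σ → Tendsto (fun M : ℝ => sineIntegral (M * σ)) atTop (𝓝 (Real.pi / 2)) :=
    fun σ hσ => tendsto_sineIntegral.comp (tendsto_id.atTop_mul_const hσ)
  have hI : Tendsto (fun M : ℝ =>
      ∫ σ in (0 : ℝ)..τ, l * Real.exp (-(l * (τ - σ))) * sineIntegral (M * σ)) atTop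
      (𝓝 (∫ σ in (0 : ℝ)..τ, l * Real.exp (-(l * (τ - σ))) * (Real.pi / 2))) := by
    refine intervalIntegral.tendsto_integral_filter_of_dominated_convergence
      (fun σ => 4 * (l * Real.exp (-(l * (τ - σ))))) ?_ ?_
      (Continuous.intervalIntegrable (by fun_prop) _ _) ?_
    · refine Eventually.of_forall fun M => Continuous.aestronglyMeasurable ?_
      have := continuous_sineIntegral
      fun_prop
    · filter_upwards [eventually_ge_atTop 0] with M hM
      refine Eventually.of_forall fun σ hσ => ?_
      rw [uIoc_of_le hτ.le] at hσ
      rw [norm_mul, mul_comm, Real.norm_of_nonneg (by positivity : 0 ≤ l * Real.exp (-(l * (τ - σ))))]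
      gcongr
      exact abs_sineIntegral_le (mul_nonneg hM hσ.1.le)
    · refine Eventually.of_forall fun σ hσ => ?_
      rw [uIoc_of_le hτ.le] at hσ
      exact (hS σ hσ.1).const_mul _
  rw [intervalIntegral.integral_mul_const, integral_mul_exp_neg] at hI
  have h := (((hat.const_mul 2).const_mul (Real.exp (-(l * τ)))).add ((hS τ hτ).const_mul 2)).sub
    (hI.const_mul 2)
  have h' := (Complex.continuous_ofReal.tendsto _).comp h
  refine (h'.congr fun M => ?_).trans (le_of_eq ?_)
  · rw [truncInv_eq hl]; rfl
  · congr 2; ring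

/-! ### Bounds and measurability for the Green's function at √(ir) -/

lemma sqrtI_sq (r : ℝ) : sqrtI r ^ 2 = Complex.I * r := by
  have := Complex.cpow_nat_inv_pow (Complex.I * r) two_ne_zero
  rw [sqrtI, one_div]
  exact_mod_cast this

lemma sqrtI_zero : sqrtI 0 = 0 := by simpa using sqrtI_sq 0

lemma sqrtI_ne_zero {r : ℝ} (hr : r ≠ 0) : sqrtI r ≠ 0 := fun h => by
  have := sqrtI_sq r
  simp [h, hr] at this

lemma norm_sqrtI_sq (r : ℝ) : ‖sqrtI r‖ ^ 2 = |r| := by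
  rw [← norm_pow, sqrtI_sq]; simp

lemma norm_sqrtI_le (r : ℝ) : ‖sqrtI r‖ ≤ 1 + |r| := by
  nlinarith [norm_sqrtI_sq r, norm_nonneg (sqrtI r)]

/-- The square is purely imaginary, so real and imaginary parts have equal modulus. This keeps √(ir)
away from the zeros of sinh other than 0. -/
lemma norm_sqrtI_le_two_mul_abs_re (r : ℝ) : ‖sqrtI r‖ ≤ 2 * |(sqrtI r).re| := by
  have h := congrArg Complex.re (sqrtI_sq r)
  rw [pow_two, Complex.mul_re] at h
  simp at h
  have h2 : ‖sqrtI r‖ ^ 2 = 2 * |(sqrtI r).re| ^ 2 := by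
    rw [Complex.sq_norm, Complex.normSq_apply, sq_abs]; linarith
  nlinarith [norm_nonneg (sqrtI r), abs_nonneg (sqrtI r).re]

lemma norm_sinh_le (w : ℂ) : ‖Complex.sinh w‖ ≤ ‖w‖ * Real.exp ‖w‖ := by
  have h1 := Complex.norm_exp_sub_sum_le_norm_mul_exp w 1
  have h2 := Complex.norm_exp_sub_sum_le_norm_mul_exp (-w) 1
  simp at h1 h2
  have : Complex.sinh w = ((Complex.exp w - 1) - (Complex.exp (-w) - 1)) / 2 := by
    rw [Complex.sinh]; ring
  rw [this, norm_div, Complex.norm_ofNat, div_le_iff₀ two_pos]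
  exact (norm_sub_le _ _).trans (by linarith)

lemma abs_re_le_norm_sinh (w : ℂ) : |w.re| ≤ ‖Complex.sinh w‖ := by
  have h := abs_norm_sub_norm_le (Complex.exp w) (Complex.exp (-w))
  rw [Complex.norm_exp, Complex.norm_exp, Complex.neg_re] at h
  have h2 : ‖Complex.sinh w‖ = ‖Complex.exp w - Complex.exp (-w)‖ / 2 := by
    rw [Complex.sinh, norm_div, Complex.norm_ofNat]
  have h3 : |Real.sinh w.re| ≤ ‖Complex.sinh w‖ := by
    rw [h2, Real.sinh_eq, abs_div, abs_two]; linarith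
  refine le_trans ?_ h3
  rcases le_total 0 w.re with h0 | h0
  · rw [abs_of_nonneg h0]
    exact (Real.self_le_sinh_iff.2 h0).trans (le_abs_self _)
  · rw [abs_of_nonpos h0]
    exact (neg_le_neg (Real.sinh_le_self_iff.2 h0)).trans (neg_le_abs _)

lemma sinh_sqrtI_ne_zero {r : ℝ} (hr : r ≠ 0) : Complex.sinh (sqrtI r) ≠ 0 := by
  rw [← norm_pos_iff]
  have := norm_pos_iff.2 (sqrtI_ne_zero hr)
  linarith [norm_sqrtI_le_two_mul_abs_re r, abs_re_le_norm_sinh (sqrtI r)]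

lemma norm_sinh_mul_le {m : ℂ} {a : ℝ} (ha : |a| ≤ 1) :
    ‖Complex.sinh (m * a)‖ ≤ ‖m‖ * Real.exp ‖m‖ := by
  have h : ‖m * a‖ ≤ ‖m‖ := by
    rw [norm_mul, Complex.norm_real]
    exact mul_le_of_le_one_right (norm_nonneg _) ha
  exact (norm_sinh_le _).trans (by gcongr)

/-- The singularity of 1/(m sinh m) at m = 0 is cancelled by the two factors |sinh(ma)| ≤ |m|
exp|m|, since |sinh m| ≥ |Re m| ≥ |m|/2. The growth in r is harmless: the bound serves only for r
fixed or bounded. -/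
lemma norm_green_sqrtI_le (r : ℝ) {x y : ℝ} (hx : x ∈ Icc (0 : ℝ) 1) (hy : y ∈ Icc (0 : ℝ) 1) :
    ‖green (sqrtI r) x y‖ ≤ 2 * Real.exp (2 * (1 + |r|)) := by
  have ax : |x| ≤ 1 := abs_le.2 ⟨by linarith [hx.1], hx.2⟩
  have ay : |y| ≤ 1 := abs_le.2 ⟨by linarith [hy.1], hy.2⟩
  have ax' : |x - 1| ≤ 1 := abs_le.2 ⟨by linarith [hx.1], by linarith [hx.2]⟩
  have ay' : |y - 1| ≤ 1 := abs_le.2 ⟨by linarith [hy.1], by linarith [hy.2]⟩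
  rcases eq_or_ne r 0 with rfl | hr
  · have h1 : ‖green (sqrtI 0) x y‖ ≤ 1 := by
      rw [sqrtI_zero, green, if_pos rfl]
      split_ifs
      · rw [norm_mul, ← Complex.ofReal_one, ← Complex.ofReal_sub, Complex.norm_real,
          Complex.norm_real, norm_sub_rev]
        exact mul_le_one₀ ax' (abs_nonneg _) ay
      · rw [norm_mul, ← Complex.ofReal_one, ← Complex.ofReal_sub, Complex.norm_real,
          Complex.norm_real, norm_sub_rev 1 y]
        exact mul_le_one₀ ax (abs_nonneg _) ay'
    have h2 : 1 ≤ Real.exp (2 * (1 + |(0 : ℝ)|)) := Real.one_le_exp (by positivity)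
    linarith
  · set m := sqrtI r
    have hm : 0 < ‖m‖ := norm_pos_iff.2 (sqrtI_ne_zero hr)
    have hs : ‖m‖ / 2 ≤ ‖Complex.sinh m‖ := by
      linarith [norm_sqrtI_le_two_mul_abs_re r, abs_re_le_norm_sinh m]
    have hprod : ∀ a b : ℝ, |a| ≤ 1 → |b| ≤ 1 →
        ‖-1 / (m * Complex.sinh m) * (Complex.sinh (m * a) * Complex.sinh (m * b))‖ ≤
          2 * Real.exp (2 * (1 + |r|)) := fun a b ha hb => by
      have h1 := norm_sinh_mul_le (m := m) ha
      have h2 := norm_sinh_mul_le (m := m) hb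
      have h3 : ‖m‖ * (‖m‖ / 2) ≤ ‖m‖ * ‖Complex.sinh m‖ := by gcongr
      have h4 : (‖m‖ * Real.exp ‖m‖) * (‖m‖ * Real.exp ‖m‖) ≤
          ‖m‖ ^ 2 * Real.exp (2 * (1 + |r|)) := by
        have : Real.exp ‖m‖ * Real.exp ‖m‖ ≤ Real.exp (2 * (1 + |r|)) := by
          rw [← Real.exp_add]
          exact Real.exp_le_exp.2 (by linarith [norm_sqrtI_le r])
        nlinarith [sq_nonneg ‖m‖]
      rw [norm_mul, norm_div, norm_neg, norm_one, norm_mul, norm_mul, div_mul_eq_mul_div, one_mul]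
      rw [div_le_iff₀ (mul_pos hm ((half_pos hm).trans_le hs))]
      calc _ ≤ (‖m‖ * Real.exp ‖m‖) * (‖m‖ * Real.exp ‖m‖) := by gcongr
        _ ≤ ‖m‖ ^ 2 * Real.exp (2 * (1 + |r|)) := h4
        _ = 2 * Real.exp (2 * (1 + |r|)) * (‖m‖ * (‖m‖ / 2)) := by ring
        _ ≤ _ := by gcongr
    rw [green, if_neg (sqrtI_ne_zero hr)]
    split_ifs
    · exact_mod_cast hprod (x - 1) y ax' ay
    · exact_mod_cast hprod x (y - 1) ax ay'

lemma measurable_sqrtI : Measurable sqrtI := by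
  unfold sqrtI
  fun_prop

lemma measurable_green {α : Type*} [MeasurableSpace α] {m : α → ℂ} {y : α → ℝ}
    (hm : Measurable m) (hy : Measurable y) (x : ℝ) :
    Measurable fun a => green (m a) x (y a) := by
  unfold green
  refine Measurable.ite (hm (measurableSet_singleton 0)) ?_ ?_
  · exact Measurable.ite (measurableSet_le hy measurable_const) (by fun_prop) (by fun_prop)
  · refine Measurable.mul (by fun_prop) ?_
    exact Measurable.ite (measurableSet_le hy measurable_const) (by fun_prop) (by fun_prop)

/-! ### Eigenfunction expansion of the resolvent -/

lemma hasDerivAt_sinh_sin_primitive (m w c : ℂ) (hw : m ^ 2 + w ^ 2 ≠ 0) (y : ℝ) :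
    HasDerivAt (fun y : ℝ => (m * Complex.cosh (m * (y - c)) * Complex.sin (w * y) -
      w * Complex.sinh (m * (y - c)) * Complex.cos (w * y)) / (m ^ 2 + w ^ 2))
      (Complex.sinh (m * (y - c)) * Complex.sin (w * y)) y := by
  have d1 : HasDerivAt (fun z : ℂ => m * (z - c)) m (y : ℂ) := by
    simpa using ((hasDerivAt_id (y : ℂ)).sub_const c).const_mul m
  have d2 : HasDerivAt (fun z : ℂ => w * z) w (y : ℂ) := by
    simpa using (hasDerivAt_id (y : ℂ)).const_mul w
  have := ((((d1.ccosh.const_mul m).mul d2.csin).sub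
    ((d1.csinh.const_mul w).mul d2.ccos)).div_const (m ^ 2 + w ^ 2)).comp_ofReal
  refine this.congr_deriv ?_
  field_simp
  ring

/-- The function sin(λₙx)/(m² + λₙ²) solves -v'' + m²v = sin(λₙx) with Dirichlet conditions. The
check is direct: the primitive is used with c = 0 left of x and c = 1 right of x, the contributions
at 0 and 1 vanish, and those at x combine by the addition formula for sinh(mx - m(x-1)). -/
lemma integral_green_mul_sin {m : ℂ} (hm : m ≠ 0) (hsm : Complex.sinh m ≠ 0) (n : ℕ)
    (hw : m ^ 2 + (freq n : ℂ) ^ 2 ≠ 0) {x : ℝ} (hx : x ∈ Icc (0 : ℝ) 1) :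
    ∫ y in (0 : ℝ)..1, green m x y * Real.sin (freq n * y) =
      Real.sin (freq n * x) / (m ^ 2 + (freq n : ℂ) ^ 2) := by
  have hint : ∀ c : ℂ, ∀ a b : ℝ, IntervalIntegrable
      (fun y : ℝ => Complex.sinh (m * (y - c)) * Complex.sin (freq n * y)) volume a b :=
    fun c a b => Continuous.intervalIntegrable (by fun_prop) _ _
  have hI : ∀ c : ℂ, ∀ a b : ℝ, _ := fun c a b =>
    intervalIntegral.integral_eq_sub_of_hasDerivAt
      (fun y _ => hasDerivAt_sinh_sin_primitive m (freq n) c hw y) (hint c a b)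
  have e1 : EqOn (fun y : ℝ => green m x y * Real.sin (freq n * y))
      (fun y : ℝ => -1 / (m * Complex.sinh m) * Complex.sinh (m * (x - 1)) *
        (Complex.sinh (m * (y - 0)) * Complex.sin (freq n * y))) (uIoc 0 x) := fun y hy => by
    rw [uIoc_of_le hx.1] at hy
    simp only [green, if_neg hm, if_pos hy.2]
    push_cast
    rw [sub_zero]
    ring
  have e2 : EqOn (fun y : ℝ => green m x y * Real.sin (freq n * y))
      (fun y : ℝ => -1 / (m * Complex.sinh m) * Complex.sinh (m * x) *
        (Complex.sinh (m * (y - 1)) * Complex.sin (freq n * y))) (uIoc x 1) := fun y hy => by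
    rw [uIoc_of_le hx.2] at hy
    simp only [green, if_neg hm, if_neg (not_le.2 hy.1)]
    push_cast
    ring
  have i1 := ((hint 0 0 x).const_mul (-1 / (m * Complex.sinh m) * Complex.sinh (m * (x - 1)))).congr
    e1.symm
  have i2 := ((hint 1 x 1).const_mul (-1 / (m * Complex.sinh m) * Complex.sinh (m * x))).congr
    e2.symm
  rw [← intervalIntegral.integral_add_adjacent_intervals i1 i2,
    intervalIntegral.integral_congr_ae (Eventually.of_forall fun y hy => e1 hy),
    intervalIntegral.integral_congr_ae (Eventually.of_forall fun y hy => e2 hy),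
    intervalIntegral.integral_const_mul, intervalIntegral.integral_const_mul, hI, hI]
  have hs1 : Complex.sin (freq n * (1 : ℝ)) = 0 := by
    rw [Complex.ofReal_one, mul_one, ← Complex.ofReal_sin, sin_freq, Complex.ofReal_zero]
  have hadd : Complex.sinh m = Complex.sinh (m * x) * Complex.cosh (m * (x - 1)) -
      Complex.cosh (m * x) * Complex.sinh (m * (x - 1)) := by
    rw [← Complex.sinh_sub]; ring_nf
  rw [hs1]
  simp only [Complex.ofReal_zero, Complex.ofReal_one, sub_zero, sub_self, mul_zero,
    Complex.sin_zero, Complex.sinh_zero, zero_mul, zero_div, zero_sub]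
  rw [Complex.ofReal_sin, Complex.ofReal_mul]
  field_simp
  rw [hadd]
  ring

/-- Expansion of the solution of the resolvent equation in Dirichlet eigenfunctions. -/
lemma hasSum_integral_green {G : ℝ → ℝ} (hG : ContinuousOn G (Icc 0 1)) (h0 : G 0 = 0)
    (h1 : G 1 = 0) (hs : Summable (sineCoeff G)) {x : ℝ} (hx : x ∈ Icc (0 : ℝ) 1) {r : ℝ}
    (hr : r ≠ 0) :
    HasSum (fun n => ((2 * sineCoeff G n * Real.sin (freq n * x) : ℝ) : ℂ) /
      ((freq n ^ 2 : ℝ) + Complex.I * r)) (∫ y in (0 : ℝ)..1, green (sqrtI r) x y * (G y : ℂ)) := by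
  have hgm : Measurable fun y => green (sqrtI r) x y :=
    measurable_green measurable_const measurable_id x
  have hterm : ∀ n, ∫ y in (0 : ℝ)..1, green (sqrtI r) x y *
      ((2 * sineCoeff G n * Real.sin (freq n * y) : ℝ) : ℂ) =
      ((2 * sineCoeff G n * Real.sin (freq n * x) : ℝ) : ℂ) /
      ((freq n ^ 2 : ℝ) + Complex.I * r) := fun n => by
    have hw : sqrtI r ^ 2 + (freq n : ℂ) ^ 2 = (freq n ^ 2 : ℝ) + Complex.I * r := by
      rw [sqrtI_sq]; push_cast; ring
    have hw0 : sqrtI r ^ 2 + (freq n : ℂ) ^ 2 ≠ 0 := by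
      rw [hw]; exact add_I_mul_ne_zero (pow_pos (freq_pos n) 2) r
    have := integral_green_mul_sin (sqrtI_ne_zero hr) (sinh_sqrtI_ne_zero hr) n hw0 hx
    rw [hw] at this
    rw [Complex.ofReal_mul, mul_div_assoc, ← this, ← intervalIntegral.integral_const_mul]
    refine intervalIntegral.integral_congr fun y _ => ?_
    simp only [Complex.ofReal_mul]
    ring
  simp only [← hterm]
  refine intervalIntegral.hasSum_integral_of_dominated_convergence
    (fun n _ => 2 * Real.exp (2 * (1 + |r|)) * (2 * |sineCoeff G n|)) (fun n => ?_) (fun n => ?_)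
    ?_ ?_ ?_
  · refine (hgm.mul ?_).aestronglyMeasurable
    fun_prop
  · refine Eventually.of_forall fun y hy => ?_
    rw [uIoc_of_le zero_le_one] at hy
    rw [norm_mul, Complex.norm_real, Real.norm_eq_abs, abs_mul, abs_mul, abs_two]
    refine mul_le_mul (norm_green_sqrtI_le r hx ⟨hy.1.le, hy.2⟩) ?_ (by positivity) (by positivity)
    · exact mul_le_of_le_one_right (by positivity) (Real.abs_sin_le_one _)
  · exact Eventually.of_forall fun y _ => (hs.abs.mul_left 2).mul_left _
  · exact intervalIntegrable_const
  · refine Eventually.of_forall fun y hy => ?_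
    rw [uIoc_of_le zero_le_one] at hy
    exact (Complex.hasSum_ofReal.2 (hasSum_sine_series hG h0 h1 hs ⟨hy.1.le, hy.2⟩)).mul_left _

/-! ### Sine coefficients of time slices -/

lemma IsCont.slice {G : ℝ → ℝ → ℝ} (hG : IsCont G) {t : ℝ} (ht : 0 ≤ t) :
    ContinuousOn (fun y => G y t) (Icc 0 1) :=
  ContinuousOn.comp hG (by fun_prop : ContinuousOn (fun y : ℝ => (y, t)) (Icc 0 1))
    fun _ hy => ⟨hy, ht⟩

lemma IsCont.sin_mul_slice {G : ℝ → ℝ → ℝ} (hG : IsCont G) (n : ℕ) {t : ℝ} (ht : 0 ≤ t) :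
    ContinuousOn (fun y => Real.sin (freq n * y) * G y t) (Icc 0 1) :=
  ContinuousOn.mul (by fun_prop) (hG.slice ht)

lemma IsCont.exists_bound {G : ℝ → ℝ → ℝ} (hG : IsCont G) (T : ℝ) :
    ∃ K, 0 ≤ K ∧ ∀ x ∈ Icc (0 : ℝ) 1, ∀ t ∈ Icc (0 : ℝ) T, |G x t| ≤ K := by
  have hsub : Icc (0 : ℝ) 1 ×ˢ Icc (0 : ℝ) T ⊆ domain := prod_mono le_rfl Icc_subset_Ici_self
  obtain ⟨K, hK⟩ := (isCompact_Icc.prod isCompact_Icc).exists_bound_of_continuousOn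
    (ContinuousOn.mono hG hsub)
  exact ⟨max K 0, le_max_right _ _, fun x hx t ht => (hK (x, t) ⟨hx, ht⟩).trans (le_max_left _ _)⟩

lemma IsCont.continuous_sineCoeff {G : ℝ → ℝ → ℝ} (hG : IsCont G) (n : ℕ) :
    Continuous fun s => sineCoeff (fun y => G y (max s 0)) n := by
  -- Clamping both variables to the domain gives a function continuous on the whole plane.
  have h1 : Continuous fun p : ℝ × ℝ => G (projIcc 0 1 zero_le_one p.2) (max p.1 0) :=
    ContinuousOn.comp_continuous (f := fun p : ℝ × ℝ =>
      (((projIcc 0 1 zero_le_one p.2 : Icc (0 : ℝ) 1) : ℝ), max p.1 0)) hG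
      ((continuous_subtype_val.comp (continuous_projIcc.comp continuous_snd)).prodMk (by fun_prop))
      fun p => ⟨Subtype.coe_prop _, le_max_right p.1 0⟩
  have h2 : Continuous fun s => ∫ y in (0 : ℝ)..1,
      Real.sin (freq n * y) * G (projIcc 0 1 zero_le_one y) (max s 0) := by
    refine intervalIntegral.continuous_parametric_intervalIntegral_of_continuous' ?_ _ _
    simp only [Function.uncurry_def]
    exact Continuous.mul (by fun_prop) h1
  refine h2.congr fun s => intervalIntegral.integral_congr fun y hy => ?_
  rw [uIcc_of_le zero_le_one] at hy
  simp only
  rw [projIcc_of_mem _ hy]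

lemma abs_sineCoeff_le_mul {G Gx Gxx : ℝ → ℝ}
    (hG : ∀ x ∈ Icc (0 : ℝ) 1, HasDerivWithinAt G (Gx x) (Icc 0 1) x)
    (hGx : ∀ x ∈ Icc (0 : ℝ) 1, HasDerivWithinAt Gx (Gxx x) (Icc 0 1) x)
    (hGxx : ContinuousOn Gxx (Icc 0 1)) (h0 : G 0 = 0) (h1 : G 1 = 0) {K : ℝ}
    (hK : ∀ x ∈ Icc (0 : ℝ) 1, |Gxx x| ≤ K) (n : ℕ) :
    |sineCoeff G n| ≤ K * (1 / freq n ^ 2) := by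
  have h := congrArg abs (freq_sq_mul_sineCoeff hG hGx hGxx h0 h1 n)
  have hp := pow_pos (freq_pos n) 2
  rw [abs_mul, abs_neg, abs_of_pos hp] at h
  rw [mul_one_div, le_div_iff₀ hp, mul_comm, h]
  exact abs_sineCoeff_le hK n

lemma one_le_freq (n : ℕ) : 1 ≤ freq n := by
  have h1 : (1 : ℝ) ≤ (n : ℝ) + 1 := by linarith [n.cast_nonneg (α := ℝ)]
  have h2 : (1 : ℝ) ≤ Real.pi := by linarith [Real.pi_gt_three]
  exact one_le_mul_of_one_le_of_one_le h1 h2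

/-! ### Duhamel modes and existence of the solution -/

/-- The solution of `c' + ((n + 1) π)² c = g`, `c 0 = 0`. -/
def mode (n : ℕ) (g : ℝ → ℝ) (t : ℝ) : ℝ :=
  ∫ s in (0 : ℝ)..t, Real.exp (-(freq n ^ 2 * (t - s))) * g s

lemma hasDerivAt_mode (n : ℕ) {g : ℝ → ℝ} (hg : Continuous g) (t : ℝ) :
    HasDerivAt (mode n g) (g t - freq n ^ 2 * mode n g t) t := by
  have he : mode n g = fun t => Real.exp (-(freq n ^ 2 * t)) *
      ∫ s in (0 : ℝ)..t, Real.exp (freq n ^ 2 * s) * g s := by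
    ext t
    rw [mode, ← intervalIntegral.integral_const_mul]
    refine intervalIntegral.integral_congr fun s _ => ?_
    rw [← mul_assoc, ← Real.exp_add]
    ring_nf
  have hc : Continuous fun s => Real.exp (freq n ^ 2 * s) * g s := by fun_prop
  have d1 : HasDerivAt (fun t => ∫ s in (0 : ℝ)..t, Real.exp (freq n ^ 2 * s) * g s)
      (Real.exp (freq n ^ 2 * t) * g t) t :=
    intervalIntegral.integral_hasDerivAt_right (hc.intervalIntegrable _ _)
      hc.stronglyMeasurable.stronglyMeasurableAtFilter hc.continuousAt
  have d2 : HasDerivAt (fun t => -(freq n ^ 2 * t)) (-freq n ^ 2) t :=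
    ((hasDerivAt_id t).const_mul (freq n ^ 2)).neg.congr_deriv (by simp)
  rw [he]
  refine (d2.exp.mul d1).congr_deriv ?_
  have : Real.exp (-(freq n ^ 2 * t)) * Real.exp (freq n ^ 2 * t) = 1 := by
    rw [← Real.exp_add]; simp
  linear_combination g t * this

lemma continuous_mode (n : ℕ) {g : ℝ → ℝ} (hg : Continuous g) : Continuous (mode n g) :=
  continuous_iff_continuousAt.2 fun t => (hasDerivAt_mode n hg t).continuousAt

lemma mode_zero (n : ℕ) (g : ℝ → ℝ) : mode n g 0 = 0 := by simp [mode]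

/-- The exponential kernel has mass at most λₙ⁻²; this gain of two powers pays for the second
x-derivative. -/
lemma freq_sq_mul_abs_mode_le (n : ℕ) {g : ℝ → ℝ} {t K : ℝ} (ht : 0 ≤ t)
    (hg : ∀ s ∈ Ioc 0 t, |g s| ≤ K) (hK : 0 ≤ K) : freq n ^ 2 * |mode n g t| ≤ K := by
  have h := intervalIntegral.norm_integral_le_of_norm_le (μ := volume) ht
    (f := fun s => Real.exp (-(freq n ^ 2 * (t - s))) * g s)
    (g := fun s => Real.exp (-(freq n ^ 2 * (t - s))) * K)
    (Eventually.of_forall fun s hs => by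
      rw [norm_mul, Real.norm_eq_abs, Real.norm_eq_abs, Real.abs_exp]
      gcongr
      exact hg s hs) (Continuous.intervalIntegrable (by fun_prop) _ _)
  rw [intervalIntegral.integral_mul_const, Real.norm_eq_abs] at h
  have h2 := integral_mul_exp_neg (l := freq n ^ 2) t
  rw [intervalIntegral.integral_const_mul] at h2
  calc freq n ^ 2 * |mode n g t|
      ≤ freq n ^ 2 * ((∫ s in (0 : ℝ)..t, Real.exp (-(freq n ^ 2 * (t - s)))) * K) := by
        gcongr; exact h
    _ = (1 - Real.exp (-(freq n ^ 2 * t))) * K := by rw [← mul_assoc, h2]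
    _ ≤ 1 * K := by gcongr; linarith [Real.exp_pos (-(freq n ^ 2 * t))]
    _ = K := one_mul K

/-- Continuous coefficients with quadratic decay, locally uniformly in time. -/
structure RegularCoeff (b : ℕ → ℝ → ℝ) : Prop where
  continuous : ∀ n, Continuous (b n)
  bound : ∀ T : ℝ, ∃ K, 0 ≤ K ∧ ∀ n, ∀ s ≤ T, |b n s| ≤ K * (1 / freq n ^ 2)

/-- The superposition of the modes driven by the coefficients `b`. -/
def modeSeries (b : ℕ → ℝ → ℝ) (x t : ℝ) : ℝ :=
  ∑' n, 2 * Real.sin (freq n * x) * mode n (b n) t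

lemma RegularCoeff.mode_bound {b : ℕ → ℝ → ℝ} (hb : RegularCoeff b) (T : ℝ) :
    ∃ K, 0 ≤ K ∧ ∀ n, ∀ t ∈ Icc (0 : ℝ) T,
      freq n ^ 2 * |mode n (b n) t| ≤ K * (1 / freq n ^ 2) := by
  obtain ⟨K, hK, h⟩ := hb.bound T
  exact ⟨K, hK, fun n t ht => freq_sq_mul_abs_mode_le n ht.1
    (fun s hs => h n s (hs.2.trans ht.2)) (by positivity)⟩

lemma isCont_tsum {g : ℕ → ℝ → ℝ → ℝ} (hg : ∀ n, Continuous fun p : ℝ × ℝ => g n p.1 p.2)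
    (hb : ∀ T : ℝ, ∃ K, ∀ n x, ∀ t ∈ Icc (0 : ℝ) T, |g n x t| ≤ K * (1 / freq n ^ 2)) :
    IsCont fun x t => ∑' n, g n x t := by
  rintro ⟨x, t⟩ ⟨hx, ht⟩
  -- The bounds are only local in time; [0,t+1] contains a relative neighbourhood of t.
  obtain ⟨K, hK⟩ := hb (t + 1)
  have hc : ContinuousOn (fun p : ℝ × ℝ => ∑' n, g n p.1 p.2) (Icc 0 1 ×ˢ Icc 0 (t + 1)) :=
    continuousOn_tsum (fun n => (hg n).continuousOn) (summable_inv_freq_sq.mul_left K)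
      fun n p hp => hK n p.1 p.2 hp.2
  refine (hc (x, t) ⟨hx, ht, by linarith⟩).mono_of_mem_nhdsWithin ?_
  have hU : {p : ℝ × ℝ | p.2 < t + 1} ∈ 𝓝 (x, t) :=
    (isOpen_lt continuous_snd continuous_const).mem_nhds (by simp)
  filter_upwards [self_mem_nhdsWithin, mem_nhdsWithin_of_mem_nhds hU] with p hp hp2
  exact ⟨hp.1, hp.2, le_of_lt hp2⟩

lemma abs_two_mul_mul_le {c a : ℝ} (hc : |c| ≤ 1) : |2 * c * a| ≤ 2 * |a| := by
  rw [abs_mul, abs_mul, abs_two]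
  nlinarith [abs_nonneg a]

lemma le_freq_sq_mul (n : ℕ) {a : ℝ} (ha : 0 ≤ a) : a ≤ freq n ^ 2 * a :=
  le_mul_of_one_le_left ha (one_le_pow₀ (one_le_freq n))

lemma hasDerivAt_freq_mul (n : ℕ) (x : ℝ) : HasDerivAt (fun x => freq n * x) (freq n) x :=
  ((hasDerivAt_id x).const_mul (freq n)).congr_deriv (mul_one _)

lemma summable_of_abs_le {a : ℕ → ℝ} {K : ℝ} (h : ∀ n, |a n| ≤ K * (1 / freq n ^ 2)) :
    Summable a :=
  Summable.of_norm_bounded (summable_inv_freq_sq.mul_left K) h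

lemma RegularCoeff.hasPartialX {b : ℕ → ℝ → ℝ} (hb : RegularCoeff b) :
    HasPartialX (modeSeries b)
      fun x t => ∑' n, 2 * Real.cos (freq n * x) * (freq n * mode n (b n) t) := by
  intro x _ t ht
  obtain ⟨K, hK, h⟩ := hb.mode_bound t
  refine (hasDerivAt_tsum (y₀ := 0)
    (g := fun n z => 2 * Real.sin (freq n * z) * mode n (b n) t)
    (g' := fun n z => 2 * Real.cos (freq n * z) * (freq n * mode n (b n) t))
    (summable_inv_freq_sq.mul_left (2 * K)) (fun n y => ?_)
    (fun n y => ?_) ?_ x).hasDerivWithinAt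
  · exact (((hasDerivAt_freq_mul n y).sin.const_mul 2).mul_const _).congr_deriv (by ring)
  · rw [Real.norm_eq_abs]
    refine (abs_two_mul_mul_le (Real.abs_cos_le_one _)).trans ?_
    rw [mul_assoc]
    gcongr
    refine le_trans ?_ (h n t ⟨ht, le_rfl⟩)
    rw [abs_mul, abs_of_pos (freq_pos n)]
    gcongr
    exact le_self_pow₀ (one_le_freq n) two_ne_zero
  · simp [summable_zero]

lemma RegularCoeff.hasPartialX_cos {b : ℕ → ℝ → ℝ} (hb : RegularCoeff b) :
    HasPartialX (fun x t => ∑' n, 2 * Real.cos (freq n * x) * (freq n * mode n (b n) t))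
      fun x t => ∑' n, 2 * Real.sin (freq n * x) * (-(freq n ^ 2 * mode n (b n) t)) := by
  intro x _ t ht
  obtain ⟨K, hK, h⟩ := hb.mode_bound t
  refine (hasDerivAt_tsum (y₀ := 0)
    (g := fun n z => 2 * Real.cos (freq n * z) * (freq n * mode n (b n) t))
    (g' := fun n z => 2 * Real.sin (freq n * z) * (-(freq n ^ 2 * mode n (b n) t)))
    (summable_inv_freq_sq.mul_left (2 * K)) (fun n y => ?_)
    (fun n y => ?_) ?_ x).hasDerivWithinAt
  · exact (((hasDerivAt_freq_mul n y).cos.const_mul 2).mul_const _).congr_deriv (by ring)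
  · rw [Real.norm_eq_abs]
    refine (abs_two_mul_mul_le (Real.abs_sin_le_one _)).trans ?_
    rw [mul_assoc, abs_neg, abs_mul, abs_of_pos (pow_pos (freq_pos n) 2)]
    exact mul_le_mul_of_nonneg_left (h n t ⟨ht, le_rfl⟩) two_pos.le
  · refine summable_of_abs_le (K := 2 * K) fun n => ?_
    refine (abs_two_mul_mul_le (Real.abs_cos_le_one _)).trans ?_
    rw [mul_assoc]
    gcongr
    refine le_trans ?_ (h n t ⟨ht, le_rfl⟩)
    rw [abs_mul, abs_of_pos (freq_pos n)]
    gcongr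
    exact le_self_pow₀ (one_le_freq n) two_ne_zero

lemma RegularCoeff.hasPartialT {b : ℕ → ℝ → ℝ} (hb : RegularCoeff b) :
    HasPartialT (modeSeries b)
      fun x t => ∑' n, 2 * Real.sin (freq n * x) * (b n t - freq n ^ 2 * mode n (b n) t) := by
  intro x _ t ht
  let d : ℕ → ℝ → ℝ := fun n τ => b n τ - freq n ^ 2 * mode n (b n) (max τ 0)
  have hd : ∀ n, Continuous (d n) := fun n =>
    (hb.continuous n).sub (continuous_const.mul
      ((continuous_mode n (hb.continuous n)).comp (by fun_prop)))
  have hint : ∀ n, ∀ τ, 0 ≤ τ → ∫ s in (0 : ℝ)..τ, d n s = mode n (b n) τ := fun n τ hτ => by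
    have h1 := intervalIntegral.integral_eq_sub_of_hasDerivAt
      (fun s _ => hasDerivAt_mode n (hb.continuous n) s)
      (((hb.continuous n).sub (continuous_const.mul
        (continuous_mode n (hb.continuous n)))).intervalIntegrable 0 τ)
    rw [mode_zero, sub_zero] at h1
    rw [← h1]
    refine intervalIntegral.integral_congr fun s hs => ?_
    rw [uIcc_of_le hτ] at hs
    simp only [d, max_eq_left hs.1]
  obtain ⟨K, hK, h⟩ := hb.bound (t + 1)
  obtain ⟨K', hK', h'⟩ := hb.mode_bound (t + 1)
  have hder : HasDerivAt (fun τ => ∑' n, 2 * Real.sin (freq n * x) * ∫ s in (0 : ℝ)..τ, d n s)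
      (∑' n, 2 * Real.sin (freq n * x) * d n t) t := by
    refine hasDerivAt_tsum_of_isPreconnected (t := Iio (t + 1)) (y₀ := 0)
      (g := fun n τ => 2 * Real.sin (freq n * x) * ∫ s in (0 : ℝ)..τ, d n s)
      (g' := fun n τ => 2 * Real.sin (freq n * x) * d n τ)
      (summable_inv_freq_sq.mul_left (2 * (K + K'))) isOpen_Iio isPreconnected_Iio
      (fun n τ _ => ?_) (fun n τ hτ => ?_) ?_ ?_ ?_
    · exact (intervalIntegral.integral_hasDerivAt_right ((hd n).intervalIntegrable _ _)
        (hd n).stronglyMeasurable.stronglyMeasurableAtFilter (hd n).continuousAt).const_mul _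
    · rw [Real.norm_eq_abs]
      refine (abs_two_mul_mul_le (Real.abs_sin_le_one _)).trans ?_
      rw [mul_assoc, add_mul]
      gcongr
      refine (abs_sub _ _).trans (add_le_add (h n τ (le_of_lt hτ)) ?_)
      rw [abs_mul, abs_of_pos (pow_pos (freq_pos n) 2)]
      exact h' n _ ⟨le_max_right _ _, max_le (le_of_lt hτ) (by linarith [mem_Ici.1 ht])⟩
    · exact lt_of_le_of_lt ht (lt_add_one t)
    · simp [summable_zero]
    · exact lt_add_one t
  have hval : ∑' n, 2 * Real.sin (freq n * x) * d n t =
      ∑' n, 2 * Real.sin (freq n * x) * (b n t - freq n ^ 2 * mode n (b n) t) := by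
    simp only [d, max_eq_left (mem_Ici.1 ht)]
  rw [hval] at hder
  refine hder.hasDerivWithinAt.congr (fun τ hτ => ?_) ?_
  · exact tsum_congr fun n => by rw [hint n τ hτ]
  · exact tsum_congr fun n => by rw [hint n t ht]

lemma RegularCoeff.isBoundedSolution {b : ℕ → ℝ → ℝ} (hb : RegularCoeff b) {K₀ : ℝ}
    (hK₀ : ∀ n s, |b n s| ≤ K₀) {F : ℝ → ℝ → ℝ}
    (hF : ∀ x ∈ Icc (0 : ℝ) 1, ∀ t ∈ Ici (0 : ℝ),
      HasSum (fun n => 2 * b n t * Real.sin (freq n * x)) (F x t)) :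
    IsBoundedSolution F (fun _ => 0) (modeSeries b) := by
  have hm : ∀ n, Continuous fun p : ℝ × ℝ => mode n (b n) p.2 := fun n =>
    (continuous_mode n (hb.continuous n)).comp continuous_snd
  have hbc : ∀ n, Continuous fun p : ℝ × ℝ => b n p.2 := fun n =>
    (hb.continuous n).comp continuous_snd
  have hxx : ∀ T : ℝ, ∃ K, ∀ n x, ∀ t ∈ Icc (0 : ℝ) T,
      |2 * Real.sin (freq n * x) * (-(freq n ^ 2 * mode n (b n) t))| ≤ K * (1 / freq n ^ 2) := by
    intro T
    obtain ⟨K, hK, h⟩ := hb.mode_bound T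
    refine ⟨2 * K, fun n x t ht => (abs_two_mul_mul_le (Real.abs_sin_le_one _)).trans ?_⟩
    rw [mul_assoc, abs_neg, abs_mul, abs_of_pos (pow_pos (freq_pos n) 2)]
    exact mul_le_mul_of_nonneg_left (h n t ht) two_pos.le
  have htt : ∀ T : ℝ, ∃ K, ∀ n x, ∀ t ∈ Icc (0 : ℝ) T,
      |2 * Real.sin (freq n * x) * (b n t - freq n ^ 2 * mode n (b n) t)| ≤
        K * (1 / freq n ^ 2) := by
    intro T
    obtain ⟨K, hK, h⟩ := hb.mode_bound T
    obtain ⟨K', hK', h'⟩ := hb.bound T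
    refine ⟨2 * (K' + K), fun n x t ht => (abs_two_mul_mul_le (Real.abs_sin_le_one _)).trans ?_⟩
    rw [mul_assoc, add_mul]
    gcongr
    refine (abs_sub _ _).trans (add_le_add (h' n t ht.2) ?_)
    rw [abs_mul, abs_of_pos (pow_pos (freq_pos n) 2)]
    exact h n t ht
  refine ⟨⟨_, _, _, hb.hasPartialT, hb.hasPartialX, hb.hasPartialX_cos, ?_, ?_, ?_, ?_⟩, ?_, ?_, ?_⟩
  · refine isCont_tsum (fun n => by have := hm n; fun_prop) fun T => ?_
    obtain ⟨K, hK, h⟩ := hb.mode_bound T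
    refine ⟨2 * K, fun n x t ht => (abs_two_mul_mul_le (Real.abs_sin_le_one _)).trans ?_⟩
    rw [mul_assoc]
    gcongr
    exact (le_freq_sq_mul n (abs_nonneg _)).trans (h n t ht)
  · exact isCont_tsum (fun n => Continuous.mul (by fun_prop)
      ((hbc n).sub (continuous_const.mul (hm n)))) htt
  · exact isCont_tsum (fun n => by have := hm n; fun_prop) hxx
  · intro x hx t ht
    obtain ⟨K, hK⟩ := hxx t
    obtain ⟨K', hK'⟩ := htt t
    have ht' : t ∈ Icc 0 t := ⟨le_of_lt ht, le_rfl⟩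
    rw [← (summable_of_abs_le fun n => hK' n x t ht').tsum_sub
      (summable_of_abs_le fun n => hK n x t ht'),
      ← (hF x (Ioo_subset_Icc_self hx) t (mem_Ici.2 (le_of_lt ht))).tsum_eq]
    exact tsum_congr fun n => by ring
  · intro t _
    simp [modeSeries, sin_freq]
  · intro x _
    simp [modeSeries, mode_zero]
  -- `RegularCoeff` bounds degrade with time, so the global bound uses K₀ instead: |cₙ(t)| ≤ K₀ λₙ⁻²
  -- for every t ≥ 0.
  · have hK0 : 0 ≤ K₀ := (abs_nonneg _).trans (hK₀ 0 0)
    refine ⟨∑' n, 2 * K₀ * (1 / freq n ^ 2), fun x _ t ht => ?_⟩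
    rw [← Real.norm_eq_abs, modeSeries]
    refine tsum_of_norm_bounded (summable_inv_freq_sq.mul_left (2 * K₀)).hasSum fun n => ?_
    rw [Real.norm_eq_abs]
    refine (abs_two_mul_mul_le (Real.abs_sin_le_one _)).trans ?_
    rw [mul_assoc]
    gcongr
    rw [mul_one_div, le_div_iff₀ (pow_pos (freq_pos n) 2), mul_comm]
    exact freq_sq_mul_abs_mode_le n ht (fun s _ => hK₀ n s) hK0

/-! ### Uniqueness through the sine coefficients -/

lemma hasDerivAt_sineCoeff {v vt : ℝ → ℝ → ℝ} (hv : HasPartialT v vt) (cv : IsCont v)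
    (cvt : IsCont vt) (n : ℕ) {t : ℝ} (ht : 0 < t) :
    HasDerivAt (fun τ => sineCoeff (fun y => v y τ) n) (sineCoeff (fun y => vt y t) n) t := by
  obtain ⟨K, hK, h⟩ := cvt.exists_bound (t + 1)
  have hU : Ioo 0 (t + 1) ∈ 𝓝 t := Ioo_mem_nhds ht (lt_add_one t)
  have hms : ∀ {G : ℝ → ℝ → ℝ}, IsCont G → ∀ τ, 0 < τ → AEStronglyMeasurable
      (fun y => Real.sin (freq n * y) * G y τ) (volume.restrict (uIoc 0 1)) := fun hG τ hτ => by
    rw [uIoc_of_le zero_le_one]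
    exact ((hG.sin_mul_slice n hτ.le).mono Ioc_subset_Icc_self).aestronglyMeasurable measurableSet_Ioc
  refine (intervalIntegral.hasDerivAt_integral_of_dominated_loc_of_deriv_le
    (F := fun τ y => Real.sin (freq n * y) * v y τ)
    (F' := fun τ y => Real.sin (freq n * y) * vt y τ) (bound := fun _ => K) hU ?_
    ((cv.sin_mul_slice n ht.le).intervalIntegrable_of_Icc zero_le_one) (hms cvt t ht) ?_
    intervalIntegrable_const ?_).2
  · filter_upwards [hU] with τ hτ
    exact hms cv τ hτ.1
  · refine Eventually.of_forall fun y hy τ hτ => ?_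
    rw [uIoc_of_le zero_le_one] at hy
    rw [norm_mul, Real.norm_eq_abs, Real.norm_eq_abs]
    calc _ ≤ 1 * |vt y τ| := by gcongr; exact Real.abs_sin_le_one _
      _ ≤ K := by rw [one_mul]; exact h y ⟨hy.1.le, hy.2⟩ τ ⟨hτ.1.le, hτ.2.le⟩
  · refine Eventually.of_forall fun y hy τ hτ => ?_
    rw [uIoc_of_le zero_le_one] at hy
    exact ((hv y ⟨hy.1.le, hy.2⟩ τ hτ.1.le).hasDerivAt (Ici_mem_nhds hτ.1)).const_mul _

/-- Every solution with zero initial values is the superposition of the driven modes. -/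
lemma IsBoundedSolution.eq_modeSeries {F v : ℝ → ℝ → ℝ} (hF : IsCont F)
    (hv : IsBoundedSolution F (fun _ => 0) v) {x : ℝ} (hx : x ∈ Icc (0 : ℝ) 1) {t : ℝ}
    (ht : 0 ≤ t) :
    v x t = modeSeries (fun n s => sineCoeff (fun y => F y (max s 0)) n) x t := by
  obtain ⟨⟨vt, vx, vxx, pt, px, pxx, cv, cvt, cvxx, pde⟩, hbdry, hinit, -⟩ := hv
  have hb : ∀ τ, 0 ≤ τ → v 0 τ = 0 ∧ v 1 τ = 0 := fun τ hτ => by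
    rcases eq_or_lt_of_le hτ with rfl | hτ
    · exact ⟨hinit 0 (by simp), hinit 1 (by simp)⟩
    · exact hbdry τ hτ
  have hFc := hF.continuous_sineCoeff
  have hcoef : ∀ n, sineCoeff (fun y => v y t) n =
      mode n (fun s => sineCoeff (fun y => F y (max s 0)) n) t := fun n => by
    let g : ℝ → ℝ := fun s => sineCoeff (fun y => F y (max s 0)) n
    -- With the integrating factor exp(λₙ²τ), the difference of the two candidates for the
    -- coefficient becomes constant; it vanishes at τ = 0.
    let φ : ℝ → ℝ := fun τ => Real.exp (freq n ^ 2 * τ) *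
      (sineCoeff (fun y => v y (max τ 0)) n - mode n g τ)
    have hφc : Continuous φ := Continuous.mul (by fun_prop)
      ((cv.continuous_sineCoeff n).sub (continuous_mode n (hFc n)))
    have hφd : ∀ τ ∈ Ioo 0 t, HasDerivAt φ 0 τ := fun τ hτ => by
      have hg : g τ = sineCoeff (fun y => vt y τ) n - sineCoeff (fun y => vxx y τ) n := by
        rw [sineCoeff, sineCoeff, ← intervalIntegral.integral_sub
          ((cvt.sin_mul_slice n hτ.1.le).intervalIntegrable_of_Icc zero_le_one)
          ((cvxx.sin_mul_slice n hτ.1.le).intervalIntegrable_of_Icc zero_le_one)]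
        simp only [← mul_sub]
        refine sineCoeff_congr (fun y hy => ?_) n
        rw [max_eq_left hτ.1.le, pde y hy τ hτ.1]
      -- The boundary values of v turn the coefficient of v_xx into -λₙ² times that of v.
      have hxx := freq_sq_mul_sineCoeff (fun y hy => px y hy τ hτ.1.le)
        (fun y hy => pxx y hy τ hτ.1.le) (cvxx.slice hτ.1.le) (hb τ hτ.1.le).1 (hb τ hτ.1.le).2 n
      have d1 : HasDerivAt (fun τ => sineCoeff (fun y => v y (max τ 0)) n)
          (sineCoeff (fun y => vt y τ) n) τ := by
        refine (hasDerivAt_sineCoeff pt cv cvt n hτ.1).congr_of_eventuallyEq ?_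
        filter_upwards [Ioi_mem_nhds hτ.1] with s hs
        rw [max_eq_left (le_of_lt hs)]
      have d2 : HasDerivAt (fun t => freq n ^ 2 * t) (freq n ^ 2) τ :=
        ((hasDerivAt_id τ).const_mul (freq n ^ 2)).congr_deriv (mul_one _)
      refine (d2.exp.mul (d1.sub (hasDerivAt_mode n (hFc n) τ))).congr_deriv ?_
      change Real.exp (freq n ^ 2 * τ) * freq n ^ 2 *
        (sineCoeff (fun y => v y (max τ 0)) n - mode n g τ) +
        Real.exp (freq n ^ 2 * τ) * (sineCoeff (fun y => vt y τ) n -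
          (g τ - freq n ^ 2 * mode n g τ)) = 0
      rw [hg, max_eq_left hτ.1.le]
      linear_combination Real.exp (freq n ^ 2 * τ) * hxx
    have hint := intervalIntegral.integral_eq_sub_of_hasDerivAt_of_le ht hφc.continuousOn hφd
      intervalIntegrable_const
    have h0 : sineCoeff (fun y => v y (max 0 0)) n = 0 := by
      rw [max_self, sineCoeff_congr (H := fun _ => 0) fun y hy => hinit y (Ioo_subset_Icc_self hy)]
      simp [sineCoeff]
    simp only [intervalIntegral.integral_zero, φ, h0, mode_zero, sub_self, mul_zero, sub_zero,
      max_eq_left ht] at hint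
    have := (mul_eq_zero.1 hint.symm).resolve_left (Real.exp_pos _).ne'
    linarith
  obtain ⟨K, -, hK⟩ := cvxx.exists_bound t
  have hsum : Summable (sineCoeff fun y => v y t) := summable_of_abs_le
    (abs_sineCoeff_le_mul (fun y hy => px y hy t ht) (fun y hy => pxx y hy t ht) (cvxx.slice ht)
      (hb t ht).1 (hb t ht).2 fun y hy => hK y hy t ⟨ht, le_rfl⟩)
  rw [← (hasSum_sine_series (cv.slice ht) (hb t ht).1 (hb t ht).2 hsum hx).tsum_eq, modeSeries]
  exact tsum_congr fun n => by rw [hcoef]; ring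

/-! ### Coefficients of the source term -/

/-- The sine coefficients of the slices `F(·, s)`, extended by constants to `s < 0`. -/
def sliceCoeff (F : ℝ → ℝ → ℝ) (n : ℕ) (s : ℝ) : ℝ := sineCoeff (fun y => F y (max s 0)) n

lemma regularCoeff_sliceCoeff {F Fx Fxx : ℝ → ℝ → ℝ} (hFx : HasPartialX F Fx)
    (hFxx : HasPartialX Fx Fxx) (cF : IsCont F) (cFxx : IsCont Fxx)
    (hb : ∀ t : ℝ, 0 ≤ t → F 0 t = 0 ∧ F 1 t = 0) : RegularCoeff (sliceCoeff F) := by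
  refine ⟨cF.continuous_sineCoeff, fun T => ?_⟩
  obtain ⟨K, hK, h⟩ := cFxx.exists_bound (max T 0)
  refine ⟨K, hK, fun n s hs => ?_⟩
  have h0 : 0 ≤ max s 0 := le_max_right _ _
  exact abs_sineCoeff_le_mul (fun y hy => hFx y hy _ h0) (fun y hy => hFxx y hy _ h0)
    (cFxx.slice h0) (hb _ h0).1 (hb _ h0).2
    (fun y hy => h y hy _ ⟨h0, max_le_max_right 0 hs⟩) n

lemma hasSum_sliceCoeff {F : ℝ → ℝ → ℝ} (cF : IsCont F) (hr : RegularCoeff (sliceCoeff F))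
    (hb : ∀ t : ℝ, 0 ≤ t → F 0 t = 0 ∧ F 1 t = 0) {x : ℝ} (hx : x ∈ Icc (0 : ℝ) 1) {t : ℝ}
    (ht : 0 ≤ t) :
    HasSum (fun n => 2 * sliceCoeff F n t * Real.sin (freq n * x)) (F x t) := by
  obtain ⟨K, -, h⟩ := hr.bound t
  have hs := summable_of_abs_le fun n => h n t le_rfl
  have := hasSum_sine_series (cF.slice (le_max_right t 0)) (hb _ (le_max_right t 0)).1
    (hb _ (le_max_right t 0)).2 hs hx
  simpa only [sliceCoeff, max_eq_left ht] using this

lemma one_le_norm_add_I_mul (n : ℕ) (r : ℝ) : 1 ≤ ‖((freq n ^ 2 : ℝ) : ℂ) + Complex.I * r‖ := by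
  refine le_trans ?_ (Complex.abs_re_le_norm _)
  simp only [Complex.add_re, Complex.ofReal_re, Complex.mul_re, Complex.I_re, Complex.I_im,
    Complex.ofReal_im, zero_mul, mul_zero, sub_self, add_zero]
  exact (one_le_pow₀ (one_le_freq n)).trans (le_abs_self _)

lemma norm_exp_I_mul (r τ : ℝ) : ‖Complex.exp (Complex.I * r * τ)‖ = 1 := by
  rw [show Complex.I * r * τ = ((r * τ : ℝ) : ℂ) * Complex.I by push_cast; ring,
    Complex.norm_exp_ofReal_mul_I]

/-! ### Passage to the principal value -/

section PrincipalValue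

variable {F : ℝ → ℝ → ℝ}

lemma abs_two_mul_sliceCoeff_mul_sin_le (n : ℕ) (s x : ℝ) :
    |2 * sliceCoeff F n s * Real.sin (freq n * x)| ≤ 2 * |sliceCoeff F n s| := by
  rw [abs_mul, abs_mul, abs_two]
  exact mul_le_of_le_one_right (by positivity) (Real.abs_sin_le_one _)

lemma RegularCoeff.term_bound (hr : RegularCoeff (sliceCoeff F)) (t : ℝ) :
    ∃ K, 0 ≤ K ∧ ∀ n, ∀ s ≤ t, ∀ x,
      |2 * sliceCoeff F n s * Real.sin (freq n * x)| ≤ K * (1 / freq n ^ 2) := by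
  obtain ⟨K, hK, h⟩ := hr.bound t
  refine ⟨2 * K, by positivity, fun n s hs x =>
    (abs_two_mul_sliceCoeff_mul_sin_le n s x).trans ?_⟩
  rw [mul_assoc]
  gcongr
  exact h n s hs

lemma continuous_term (hr : RegularCoeff (sliceCoeff F)) (n : ℕ) (x : ℝ) :
    Continuous fun s => 2 * sliceCoeff F n s * Real.sin (freq n * x) :=
  (continuous_const.mul (hr.continuous n)).mul continuous_const

lemma integral_integrand (x t s r : ℝ) :
    ∫ y in (0 : ℝ)..1, integrand F x t s r y = Complex.exp (Complex.I * r * (t - s : ℝ)) *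
      ∫ y in (0 : ℝ)..1, green (sqrtI r) x y * (F y s : ℂ) := by
  rw [← intervalIntegral.integral_const_mul]
  refine intervalIntegral.integral_congr fun y _ => ?_
  simp only [integrand]
  push_cast
  ring

lemma hasSum_integral_integrand (cF : IsCont F) (hr : RegularCoeff (sliceCoeff F))
    (hb : ∀ t : ℝ, 0 ≤ t → F 0 t = 0 ∧ F 1 t = 0) {x : ℝ} (hx : x ∈ Icc (0 : ℝ) 1) (t : ℝ) {s : ℝ}
    (hs : 0 ≤ s) {r : ℝ} (hr0 : r ≠ 0) :
    HasSum (fun n => ((2 * sliceCoeff F n s * Real.sin (freq n * x) : ℝ) : ℂ) *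
      (Complex.exp (Complex.I * r * (t - s : ℝ)) / ((freq n ^ 2 : ℝ) + Complex.I * r)))
      (∫ y in (0 : ℝ)..1, integrand F x t s r y) := by
  obtain ⟨K, -, h⟩ := hr.bound s
  have hsum : Summable (sineCoeff fun y => F y s) := by
    have := summable_of_abs_le fun n => h n s le_rfl
    simpa only [sliceCoeff, max_eq_left hs] using this
  rw [integral_integrand]
  refine ((hasSum_integral_green (cF.slice hs) (hb s hs).1 (hb s hs).2 hsum hx hr0).mul_left
    (Complex.exp (Complex.I * r * (t - s : ℝ)))).congr_fun fun n => ?_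
  rw [sliceCoeff, max_eq_left hs]
  ring

lemma truncated_integral (cF : IsCont F) (hr : RegularCoeff (sliceCoeff F))
    (hb : ∀ t : ℝ, 0 ≤ t → F 0 t = 0 ∧ F 1 t = 0) {x : ℝ} (hx : x ∈ Icc (0 : ℝ) 1) (t : ℝ) {s : ℝ}
    (hs : 0 ≤ s) (M : ℝ) :
    IntervalIntegrable (fun r => ∫ y in (0 : ℝ)..1, integrand F x t s r y) volume (-M) M ∧
    ∫ r in (-M)..M, ∫ y in (0 : ℝ)..1, integrand F x t s r y =
      ∑' n, ((2 * sliceCoeff F n s * Real.sin (freq n * x) : ℝ) : ℂ) *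
        truncInv (freq n ^ 2) (t - s) M := by
  obtain ⟨K, -, hK⟩ := hr.term_bound s
  -- The resolvent expansion is established only for r ≠ 0, where m ≠ 0; the point r = 0 is null.
  have hne : ∀ᵐ r : ℝ, r ≠ 0 := by simp [ae_iff]
  have hterm : ∀ n (r : ℝ), ‖((2 * sliceCoeff F n s * Real.sin (freq n * x) : ℝ) : ℂ) *
      (Complex.exp (Complex.I * r * (t - s : ℝ)) / ((freq n ^ 2 : ℝ) + Complex.I * r))‖ ≤
      K * (1 / freq n ^ 2) := fun n r => by
    rw [norm_mul, norm_div, norm_exp_I_mul, Complex.norm_real, Real.norm_eq_abs]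
    refine le_trans ?_ (hK n s le_rfl x)
    exact mul_le_of_le_one_right (abs_nonneg _)
      ((div_le_one (zero_lt_one.trans_le (one_le_norm_add_I_mul n r))).2
        (one_le_norm_add_I_mul n r))
  have hcont : ∀ n, Continuous fun r : ℝ =>
      ((2 * sliceCoeff F n s * Real.sin (freq n * x) : ℝ) : ℂ) *
      (Complex.exp (Complex.I * r * (t - s : ℝ)) / ((freq n ^ 2 : ℝ) + Complex.I * r)) := fun n =>
    continuous_const.mul (Continuous.div (by fun_prop) (by fun_prop)
      fun r => add_I_mul_ne_zero (pow_pos (freq_pos n) 2) r)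
  have hsm := summable_inv_freq_sq.mul_left K
  constructor
  · refine ((continuous_tsum hcont hsm hterm).intervalIntegrable (-M) M).congr_ae ?_
    refine ae_restrict_of_ae ?_
    filter_upwards [hne] with r hr0
    exact (hasSum_integral_integrand cF hr hb hx t hs hr0).tsum_eq
  · have := intervalIntegral.hasSum_integral_of_dominated_convergence (μ := volume)
      (a := -M) (b := M) (fun n _ => K * (1 / freq n ^ 2))
      (fun n => (hcont n).aestronglyMeasurable)
      (fun n => Eventually.of_forall fun r _ => hterm n r)
      (Eventually.of_forall fun r _ => hsm) intervalIntegrable_const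
      (by
        filter_upwards [hne] with r hr0 _
        exact hasSum_integral_integrand cF hr hb hx t hs hr0)
    rw [← this.tsum_eq]
    refine tsum_congr fun n => ?_
    rw [intervalIntegral.integral_const_mul, truncInv]

/-- The inner principal value: `2π` times the heat semigroup for time `t - s` applied to
`F(·, s)`. -/
def innerPV (F : ℝ → ℝ → ℝ) (x t s : ℝ) : ℝ :=
  ∑' n, 2 * sliceCoeff F n s * Real.sin (freq n * x) *
    (2 * Real.pi * Real.exp (-(freq n ^ 2 * (t - s))))

lemma abs_innerPV_term_le {a K l τ : ℝ} (ha : |a| ≤ K) (hl : 0 ≤ l) (hτ : 0 ≤ τ) :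
    |a * (2 * Real.pi * Real.exp (-(l * τ)))| ≤ 2 * Real.pi * K := by
  have he : Real.exp (-(l * τ)) ≤ 1 := Real.exp_le_one_iff.2 (by nlinarith)
  rw [abs_mul, abs_of_pos (by positivity : 0 < 2 * Real.pi * Real.exp (-(l * τ))), mul_comm]
  refine mul_le_mul ?_ ha (abs_nonneg _) (by positivity)
  exact mul_le_of_le_one_right (by positivity) he

lemma continuousOn_innerPV (hr : RegularCoeff (sliceCoeff F)) (x t : ℝ) :
    ContinuousOn (innerPV F x t) (Icc 0 t) := by
  obtain ⟨K, -, hK⟩ := hr.term_bound t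
  refine continuousOn_tsum (fun n => Continuous.continuousOn ?_)
    ((summable_inv_freq_sq.mul_left K).mul_left (2 * Real.pi)) fun n s hs => ?_
  · exact (continuous_term hr n x).mul (by fun_prop)
  · exact abs_innerPV_term_le (hK n s hs.2 x) (sq_nonneg _) (sub_nonneg.2 hs.2)

/-- Termwise integration is Duhamel's formula for each mode. -/
lemma integral_innerPV (hr : RegularCoeff (sliceCoeff F)) (x : ℝ) {t : ℝ} (ht : 0 ≤ t) :
    ∫ s in (0 : ℝ)..t, innerPV F x t s = 2 * Real.pi * modeSeries (sliceCoeff F) x t := by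
  obtain ⟨K, -, hK⟩ := hr.term_bound t
  have hsm := (summable_inv_freq_sq.mul_left K).mul_left (2 * Real.pi)
  have hbd : ∀ n, ∀ s ∈ uIoc 0 t, ‖2 * sliceCoeff F n s * Real.sin (freq n * x) *
      (2 * Real.pi * Real.exp (-(freq n ^ 2 * (t - s))))‖ ≤
      2 * Real.pi * (K * (1 / freq n ^ 2)) := fun n s hs => by
    rw [uIoc_of_le ht] at hs
    exact abs_innerPV_term_le (hK n s hs.2 x) (sq_nonneg _) (sub_nonneg.2 hs.2)
  have := intervalIntegral.hasSum_integral_of_dominated_convergence (μ := volume)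
    (a := 0) (b := t) (f := innerPV F x t)
    (F := fun n s => 2 * sliceCoeff F n s * Real.sin (freq n * x) *
      (2 * Real.pi * Real.exp (-(freq n ^ 2 * (t - s)))))
    (fun n _ => 2 * Real.pi * (K * (1 / freq n ^ 2)))
    (fun n => ((continuous_term hr n x).mul (by fun_prop)).aestronglyMeasurable)
    (fun n => Eventually.of_forall (hbd n))
    (Eventually.of_forall fun s _ => hsm) intervalIntegrable_const
    (Eventually.of_forall fun s hs => (Summable.of_norm_bounded hsm fun n => hbd n s hs).hasSum)
  rw [← this.tsum_eq, modeSeries, ← tsum_mul_left]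
  refine tsum_congr fun n => ?_
  rw [mode, ← intervalIntegral.integral_const_mul, ← intervalIntegral.integral_const_mul]
  refine intervalIntegral.integral_congr fun s _ => ?_
  ring

lemma norm_term_mul_truncInv_le {a K τ M : ℝ} (n : ℕ) (ha : |a| ≤ K) (hτ : 0 ≤ τ) (hM : 0 ≤ M) :
    ‖(a : ℂ) * truncInv (freq n ^ 2) τ M‖ ≤ 20 * K := by
  rw [norm_mul, Complex.norm_real, Real.norm_eq_abs, mul_comm]
  exact mul_le_mul (norm_truncInv_le (pow_pos (freq_pos n) 2) hτ hM) ha (abs_nonneg _)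
    (by norm_num)

lemma tendsto_tsum_truncInv (hr : RegularCoeff (sliceCoeff F)) (x : ℝ) {s t : ℝ} (hst : s < t) :
    Tendsto (fun M => ∑' n, ((2 * sliceCoeff F n s * Real.sin (freq n * x) : ℝ) : ℂ) *
      truncInv (freq n ^ 2) (t - s) M) atTop (𝓝 (innerPV F x t s : ℂ)) := by
  obtain ⟨K, -, hK⟩ := hr.term_bound t
  rw [innerPV, Complex.ofReal_tsum]
  refine tendsto_tsum_of_dominated_convergence ((summable_inv_freq_sq.mul_left K).mul_left 20)
    (fun n => ?_) ?_
  · rw [Complex.ofReal_mul (2 * sliceCoeff F n s * Real.sin (freq n * x))]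
    exact (tendsto_truncInv (pow_pos (freq_pos n) 2) (sub_pos.2 hst)).const_mul _
  · filter_upwards [eventually_ge_atTop 0] with M hM n
    exact norm_term_mul_truncInv_le n (hK n s hst.le x) (sub_pos.2 hst).le hM

/-- The bound 20 on `truncInv` gives a majorant constant in s and M, so the limit passes through the
s-integral. -/
lemma tendsto_integral_tsum_truncInv (hr : RegularCoeff (sliceCoeff F)) (x : ℝ) {t : ℝ}
    (ht : 0 ≤ t) :
    Tendsto (fun M => ∫ s in (0 : ℝ)..t,
      ∑' n, ((2 * sliceCoeff F n s * Real.sin (freq n * x) : ℝ) : ℂ) *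
        truncInv (freq n ^ 2) (t - s) M) atTop (𝓝 (∫ s in (0 : ℝ)..t, (innerPV F x t s : ℂ))) := by
  obtain ⟨K, -, hK⟩ := hr.term_bound t
  have hsm := (summable_inv_freq_sq.mul_left K).mul_left 20
  -- At s = t the truncated integrals have the wrong limit (τ = 0), on a null set.
  have hne : ∀ᵐ s : ℝ, s ≠ t := by simp [ae_iff]
  refine intervalIntegral.tendsto_integral_filter_of_dominated_convergence
    (fun _ => ∑' n, 20 * (K * (1 / freq n ^ 2))) ?_ ?_ intervalIntegrable_const ?_
  · filter_upwards [eventually_ge_atTop 0] with M hM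
    rw [uIoc_of_le ht]
    refine (ContinuousOn.aestronglyMeasurable (continuousOn_tsum (fun n =>
      Continuous.continuousOn ?_) hsm fun n s hs =>
        norm_term_mul_truncInv_le n (hK n s hs.2 x) (sub_nonneg.2 hs.2) hM) measurableSet_Ioc)
    exact (Complex.continuous_ofReal.comp (continuous_term hr n x)).mul
      ((continuous_truncInv (pow_pos (freq_pos n) 2) M).comp (by fun_prop))
  · filter_upwards [eventually_ge_atTop 0] with M hM
    refine Eventually.of_forall fun s hs => ?_
    rw [uIoc_of_le ht] at hs
    exact tsum_of_norm_bounded hsm.hasSum fun n =>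
      norm_term_mul_truncInv_le n (hK n s hs.2 x) (sub_nonneg.2 hs.2) hM
  · filter_upwards [hne] with s hs hst
    rw [uIoc_of_le ht] at hst
    exact tendsto_tsum_truncInv hr x (lt_of_le_of_ne hst.2 hs)

lemma integrableOn_integrand (cF : IsCont F) (hbd : IsBdd F) {x : ℝ} (hx : x ∈ Icc (0 : ℝ) 1)
    (t M : ℝ) :
    IntegrableOn (fun p : ℝ × ℝ × ℝ => integrand F x t p.1 p.2.1 p.2.2)
      (Icc 0 t ×ˢ Icc (-M) M ×ˢ Icc 0 1) := by
  obtain ⟨C, hC⟩ := hbd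
  have hms : MeasurableSet (Icc 0 t ×ˢ Icc (-M) M ×ˢ Icc (0 : ℝ) 1) :=
    measurableSet_Icc.prod (measurableSet_Icc.prod measurableSet_Icc)
  have hfin : volume (Icc 0 t ×ˢ Icc (-M) M ×ˢ Icc (0 : ℝ) 1) < ⊤ :=
    (isCompact_Icc.prod (isCompact_Icc.prod isCompact_Icc)).measure_lt_top
  have hF : ContinuousOn (fun p : ℝ × ℝ × ℝ => ((F p.2.2 p.1 : ℝ) : ℂ))
      (Icc 0 t ×ˢ Icc (-M) M ×ˢ Icc (0 : ℝ) 1) :=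
    Complex.continuous_ofReal.comp_continuousOn
      (ContinuousOn.comp (f := fun p : ℝ × ℝ × ℝ => (p.2.2, p.1)) cF (by fun_prop)
        fun p hp => ⟨hp.2.2, hp.1.1⟩)
  refine IntegrableOn.of_bound hfin ?_ (2 * Real.exp (2 * (1 + |M|)) * C) ?_
  · refine AEStronglyMeasurable.mul (Measurable.aestronglyMeasurable ?_)
      (hF.aestronglyMeasurable hms)
    exact Measurable.mul (by fun_prop)
      (measurable_green (measurable_sqrtI.comp (by fun_prop)) (by fun_prop) x)
  · filter_upwards [ae_restrict_mem hms] with p hp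
    have hM : |p.2.1| ≤ |M| := (abs_le.2 ⟨hp.2.1.1, hp.2.1.2⟩).trans (le_abs_self M)
    have he : ‖Complex.exp (Complex.I * p.2.1 * (t - p.1))‖ = 1 := by
      have := norm_exp_I_mul p.2.1 (t - p.1)
      rwa [Complex.ofReal_sub] at this
    rw [integrand, norm_mul, norm_mul, he, one_mul, Complex.norm_real, Real.norm_eq_abs]
    refine mul_le_mul ((norm_green_sqrtI_le p.2.1 hx hp.2.2).trans ?_)
      (hC _ hp.2.2 _ hp.1.1) (abs_nonneg _) (by positivity)
    gcongr

end PrincipalValue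

end HeatDirichlet

end

theorem theorem2p4 (F Fx Fxx : ℝ → ℝ → ℝ)
    (hFx : HeatDirichlet.HasPartialX F Fx) (hFxx : HeatDirichlet.HasPartialX Fx Fxx)
    (hF_cont : HeatDirichlet.IsCont F) (hFx_cont : HeatDirichlet.IsCont Fx)
    (hFxx_cont : HeatDirichlet.IsCont Fxx) (hF_bdd : HeatDirichlet.IsBdd F)
    (hF_bdry : ∀ t : ℝ, 0 ≤ t → F 0 t = 0 ∧ F 1 t = 0)
    (hFxx_bdry : ∀ t : ℝ, 0 ≤ t → Fxx 0 t = 0 ∧ Fxx 1 t = 0) :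
    ∃ u : ℝ → ℝ → ℝ,
      HeatDirichlet.IsBoundedSolution F (fun _ => 0) u ∧
      (∀ v : ℝ → ℝ → ℝ, HeatDirichlet.IsBoundedSolution F (fun _ => 0) v →
        ∀ x ∈ Icc (0 : ℝ) 1, ∀ t ∈ Ici (0 : ℝ), v x t = u x t) ∧
      ∀ x ∈ Icc (0 : ℝ) 1, ∀ t ∈ Ici (0 : ℝ),
        -- the truncated triple integrals converge absolutely
        (∀ M : ℝ, IntegrableOn
          (fun p : ℝ × ℝ × ℝ => HeatDirichlet.integrand F x t p.1 p.2.1 p.2.2)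
          (Icc 0 t ×ˢ Icc (-M) M ×ˢ Icc 0 1)) ∧
        -- principal value of the whole triple integral
        Tendsto (fun M : ℝ => (1 / (2 * Real.pi) : ℂ) *
            ∫ s in (0 : ℝ)..t, ∫ r in (-M)..M, ∫ y in (0 : ℝ)..1,
              HeatDirichlet.integrand F x t s r y)
          atTop (𝓝 (u x t : ℂ)) ∧
        -- the same with the principal value taken inside the integral in `s`
        ∃ w : ℝ → ℂ,
          (∀ s ∈ Ico 0 t, HeatDirichlet.HasPVIntegral
            (fun r => ∫ y in (0 : ℝ)..1, HeatDirichlet.integrand F x t s r y) (w s)) ∧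
          IntervalIntegrable w volume 0 t ∧
          (u x t : ℂ) = (1 / (2 * Real.pi) : ℂ) * ∫ s in (0 : ℝ)..t, w s := by
  have hr := HeatDirichlet.regularCoeff_sliceCoeff hFx hFxx hF_cont hFxx_cont hF_bdry
  obtain ⟨C, hC⟩ := id hF_bdd
  have hpi : (2 * Real.pi : ℂ) ≠ 0 := by
    exact_mod_cast (by positivity : (2 * Real.pi : ℝ) ≠ 0)
  refine ⟨HeatDirichlet.modeSeries (HeatDirichlet.sliceCoeff F), ?_, ?_, ?_⟩
  · exact hr.isBoundedSolution
      (fun n s => HeatDirichlet.abs_sineCoeff_le (fun y hy => hC y hy _ (le_max_right s (0 : ℝ))) n)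
      fun x hx t ht => HeatDirichlet.hasSum_sliceCoeff hF_cont hr hF_bdry hx ht
  · exact fun v hv x hx t ht => hv.eq_modeSeries hF_cont hx ht
  intro x hx t ht
  have hw : ∫ s in (0 : ℝ)..t, (HeatDirichlet.innerPV F x t s : ℂ) =
      2 * Real.pi * (HeatDirichlet.modeSeries (HeatDirichlet.sliceCoeff F) x t : ℂ) := by
    rw [intervalIntegral.integral_ofReal, HeatDirichlet.integral_innerPV hr x ht]
    push_cast
    rfl
  have hu : (HeatDirichlet.modeSeries (HeatDirichlet.sliceCoeff F) x t : ℂ) =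
      (1 / (2 * Real.pi) : ℂ) * ∫ s in (0 : ℝ)..t, (HeatDirichlet.innerPV F x t s : ℂ) := by
    rw [hw, ← mul_assoc, one_div, inv_mul_cancel₀ hpi, one_mul]
  refine ⟨HeatDirichlet.integrableOn_integrand hF_cont hF_bdd hx t, ?_,
    fun s => (HeatDirichlet.innerPV F x t s : ℂ), fun s hs => ⟨fun M =>
      (HeatDirichlet.truncated_integral hF_cont hr hF_bdry hx t hs.1 M).1, ?_⟩, ?_, hu⟩
  · rw [hu]
    -- The series formula for the truncated integral holds on all of [0,t], including s = t, so the
    -- s-integrals agree for each M.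
    refine ((HeatDirichlet.tendsto_integral_tsum_truncInv hr x ht).congr fun M => ?_).const_mul _
    refine intervalIntegral.integral_congr fun s hs => ?_
    rw [uIcc_of_le ht] at hs
    exact (HeatDirichlet.truncated_integral hF_cont hr hF_bdry hx t hs.1 M).2.symm
  · refine (HeatDirichlet.tendsto_tsum_truncInv hr x hs.2).congr fun M => ?_
    exact (HeatDirichlet.truncated_integral hF_cont hr hF_bdry hx t hs.1 M).2.symm
  · exact (Complex.continuous_ofReal.comp_continuousOn
      (HeatDirichlet.continuousOn_innerPV hr x t)).intervalIntegrable_of_Icc ht
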